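/- **Definitions.** For a finite nonempty graph $G$, let $\mathbf{I}(G)$ be the random greedy maximal independent set: the vertices are inspected in a uniformly random order, and a vertex is added if it has no neighbour among the vertices added before it. Let $\iota(G)=|\mathbf{I}(G)|/|V(G)|$. Let $\mathcal{G}_\bullet$ be the space of rooted, locally finite, connected graphs up to rooted isomorphism, with the metric $d_{\mathrm{loc}}((G_1,\rho_1),(G_2,\rho_2))=2^{-R}$, where $R\in\{0,1,2,\dots,\infty\}$ is largest such that the balls $B_{G_1}(\rho_1,R)$ and $B_{G_2}(\rho_2,R)$ are isomorphic as rooted graphs (so the distance is $0$ for isomorphic rooted graphs), and let $(U,\rho)$ be a random element of $\mathcal{G}_\bullet$. Give the vertices of $U$ i.i.d. labels $\sigma_v$, uniform in $[0,1]$. The past $\mathcal{P}_\rho$ of $\rho$ is the set of vertices reachable from $\rho$ by a path along which the labels decrease (including $\rho$). If $\mathcal{P}_\rho$ is almost surely finite, $(U,\rho)$ is said to have nonexplosive growth, and $\iota(U,\rho)=\Pr[\rho\in\mathbf{I}(U[\mathcal{P}_\rho])]$, where the vertices of $\mathcal{P}_\rho$ are inspected in increasing order of their labels. Let $(G_n)$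 be a sequence of (possibly random) finite nonempty graphs with $|V(G_n)|\to\infty$ (in probability, if random). Given $G_n$, let $\rho_n$ be a uniformly random vertex of $G_n$, and let $\mathcal{N}_{G_n}(r)$ be the number of paths of length at most $r$ that start at $\rho_n$. Put $$\mu^*(r)=\lim_{M\to\infty}\limsup_{n\to\infty}\mathbb{E}[\min(\mathcal{N}_{G_n}(r),M)],$$ the expectation being over $G_n$ and $\rho_n$. The sequence has subfactorial path growth if $\mu^*(r)/r!\to0$ as $r\to\infty$. It converges locally to $(U,\rho)$ if for every $r\ge0$ the ball $B_{G_n}(\rho_n,r)$ converges in distribution to $B_U(\rho,r)$; for random $G_n$ this is understood conditionally on $G_n$, in probability, that is, for every $r\ge 0$ and every bounded continuous $f:\mathcal{G}_\bullet\to\mathbb{R}$, $$\mathbb{E}[f(B_{G_n}(\rho_n,r))\mid G_n]\to\mathbb{E}[f(B_U(\rho,r))]\quad\text{in probability.}$$ **Theorem.** If $(G_n)$ has subfactorial path growth and converges locally to $(U,\rho)$, then $(U,\rho)$ has nonexplosive growth, and $\iota(G_n)\sim\iota(U,\rho)$ with high probability: for every $\varepsilon>0$, $$\Pr\big[\,|\iota(G_n)-\iota(U,\rho)|\le\varepsilon\,\iota(U,\rho)\,\big]\to1\qquad(n\to\infty),$$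 the probability being over $G_n$ and the random order of its vertices. -/

import Mathlib

open MeasureTheory Filter Topology
open scoped ENNReal BoundedContinuousFunction

noncomputable section

namespace GreedyMIS

/-! ### Balls in graphs -/

/-- The set of vertices at graph distance at most `r` from `v`. -/
def ballSet {V : Type*} (G : SimpleGraph V) (v : V) (r : ℕ) : Set V :=
  {w | G.edist v w ≤ r}

theorem mem_ballSet_iff {V : Type*} {G : SimpleGraph V} {v w : V} {r : ℕ} :
    w ∈ ballSet G v r ↔ ∃ p : G.Walk v w, p.length ≤ r := by
  constructor
  · intro h
    have h' : G.edist v w ≤ r := h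
    obtain ⟨p, hp⟩ := SimpleGraph.exists_walk_of_edist_ne_top
      (ne_top_of_le_ne_top (ENat.natCast_ne_top r) h')
    refine ⟨p, ?_⟩
    rw [← hp] at h'
    exact_mod_cast h'
  · rintro ⟨p, hp⟩
    exact (SimpleGraph.edist_le p).trans (by exact_mod_cast hp)

theorem self_mem_ballSet {V : Type*} (G : SimpleGraph V) (v : V) (r : ℕ) :
    v ∈ ballSet G v r :=
  mem_ballSet_iff.2 ⟨SimpleGraph.Walk.nil, by simp⟩

theorem walk_support_subset_ballSet {V : Type*} {G : SimpleGraph V} {v w : V} {r : ℕ}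
    (p : G.Walk v w) (hp : p.length ≤ r) : ∀ x ∈ p.support, x ∈ ballSet G v r := by
  classical
  intro x hx
  exact mem_ballSet_iff.2 ⟨p.takeUntil x hx, (p.length_takeUntil_le_length hx).trans hp⟩

/-- A walk of length at most `r` from the centre stays inside the ball of radius `r`. -/
theorem exists_walk_induce {V : Type*} {G : SimpleGraph V} {v w : V} {r R : ℕ} (hrR : r ≤ R)
    (hw : w ∈ ballSet G v R) (p : G.Walk v w) (hp : p.length ≤ r) :
    ∃ q : (G.induce (ballSet G v R)).Walk ⟨v, self_mem_ballSet G v R⟩ ⟨w, hw⟩, q.length ≤ r := by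
  refine ⟨p.induce _ (walk_support_subset_ballSet p (hp.trans hrR)), ?_⟩
  have h : ((p.induce _ (walk_support_subset_ballSet p (hp.trans hrR))).map
    (SimpleGraph.Embedding.induce (ballSet G v R)).toHom).length = p.length := by
    rw [SimpleGraph.Walk.map_induce]
    rfl
  rw [SimpleGraph.Walk.length_map] at h
  omega

theorem ballSet_connected {V : Type*} (G : SimpleGraph V) (v : V) (r : ℕ) :
    (G.induce (ballSet G v r)).Connected := by
  refine SimpleGraph.connected_iff_exists_forall_reachable _ |>.2
    ⟨⟨v, self_mem_ballSet G v r⟩, ?_⟩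
  rintro ⟨w, hw⟩
  obtain ⟨p, hp⟩ := mem_ballSet_iff.1 hw
  obtain ⟨q, -⟩ := exists_walk_induce le_rfl hw p hp
  exact q.reachable

theorem induce_locallyFinite {V : Type*} {G : SimpleGraph V}
    (hG : ∀ w, (G.neighborSet w).Finite) (s : Set V) (w : s) :
    ((G.induce s).neighborSet w).Finite :=
  Set.Finite.preimage (f := ((↑) : s → V)) Subtype.val_injective.injOn (hG w)

/-! ### The space of rooted locally finite connected graphs -/

/-- A rooted locally finite connected graph.  (Such a graph is countable, so every one of them is
isomorphic to one whose vertices form a type in the lowest universe.) -/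
structure RootedGraph where
  /-- the vertices -/
  V : Type
  /-- the edges -/
  graph : SimpleGraph V
  /-- the root -/
  root : V
  connected : graph.Connected
  locallyFinite : ∀ v, (graph.neighborSet v).Finite

/-- The ball of radius `r` around `v`, as a graph rooted at `v`. -/
def ballAt {V : Type} (G : SimpleGraph V) (hG : ∀ w, (G.neighborSet w).Finite) (v : V) (r : ℕ) :
    RootedGraph where
  V := ballSet G v r
  graph := G.induce (ballSet G v r)
  root := ⟨v, self_mem_ballSet G v r⟩
  connected := ballSet_connected G v r
  locallyFinite := induce_locallyFinite hG _

/-- The ball of radius `r` around the root. -/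
def RootedGraph.ball (X : RootedGraph) (r : ℕ) : RootedGraph :=
  ballAt X.graph X.locallyFinite X.root r

/-- Root preserving isomorphism of rooted graphs. -/
def RootedIso (X Y : RootedGraph) : Prop :=
  ∃ e : X.graph ≃g Y.graph, e X.root = Y.root

theorem RootedIso.refl (X : RootedGraph) : RootedIso X X :=
  ⟨SimpleGraph.Iso.refl, rfl⟩

theorem RootedIso.symm {X Y : RootedGraph} (h : RootedIso X Y) : RootedIso Y X := by
  obtain ⟨e, he⟩ := h
  exact ⟨e.symm, by rw [← he]; exact e.symm_apply_apply _⟩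

theorem RootedIso.trans {X Y Z : RootedGraph} (h : RootedIso X Y) (h' : RootedIso Y Z) :
    RootedIso X Z := by
  obtain ⟨e, he⟩ := h
  obtain ⟨f, hf⟩ := h'
  exact ⟨e.trans f, by rw [← hf, ← he]; rfl⟩

/-- Isomorphic rooted graphs have isomorphic balls. -/
theorem RootedIso.ball {X Y : RootedGraph} (h : RootedIso X Y) (r : ℕ) :
    RootedIso (X.ball r) (Y.ball r) := by
  obtain ⟨e, he⟩ := h
  have hmem : ∀ x, x ∈ ballSet X.graph X.root r ↔ e x ∈ ballSet Y.graph Y.root r := by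
    intro x
    rw [mem_ballSet_iff, mem_ballSet_iff]
    constructor
    · rintro ⟨p, hp⟩
      exact ⟨(p.map e.toHom).copy he rfl, by simpa using hp⟩
    · rintro ⟨p, hp⟩
      have h1 : e.symm.toHom Y.root = X.root := by rw [← he]; exact e.symm_apply_apply _
      have h2 : e.symm.toHom (e x) = x := e.symm_apply_apply _
      exact ⟨(p.map e.symm.toHom).copy h1 h2, by simpa using hp⟩
  refine ⟨⟨e.toEquiv.subtypeEquiv hmem, ?_⟩, ?_⟩
  · rintro ⟨a, ha⟩ ⟨b, hb⟩
    exact e.map_adj_iff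
  · exact Subtype.ext he

/-- The ball of radius `r` inside the ball of radius `R ≥ r` is the ball of radius `r`. -/
theorem RootedGraph.ball_ball (X : RootedGraph) {r R : ℕ} (hrR : r ≤ R) :
    RootedIso ((X.ball R).ball r) (X.ball r) := by
  have hmem : ∀ x : (X.ball R).V,
      x ∈ ballSet (X.ball R).graph (X.ball R).root r ↔ x.1 ∈ ballSet X.graph X.root r := by
    intro x
    refine Iff.trans mem_ballSet_iff (Iff.trans ?_ mem_ballSet_iff.symm)
    constructor
    · rintro ⟨p, hp⟩
      exact ⟨p.map (SimpleGraph.Embedding.induce (ballSet X.graph X.root R)).toHom,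
        (SimpleGraph.Walk.length_map _ p).trans_le hp⟩
    · rintro ⟨p, hp⟩
      exact exists_walk_induce hrR x.2 p hp
  have hR : ∀ x, x ∈ ballSet X.graph X.root r → x ∈ ballSet X.graph X.root R := by
    intro x hx
    obtain ⟨p, hp⟩ := mem_ballSet_iff.1 hx
    exact mem_ballSet_iff.2 ⟨p, hp.trans hrR⟩
  refine ⟨⟨⟨fun x => ⟨x.1.1, (hmem x.1).1 x.2⟩,
    fun x => ⟨⟨x.1, hR x.1 x.2⟩, (hmem ⟨x.1, hR x.1 x.2⟩).2 x.2⟩,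
    fun x => rfl, fun x => rfl⟩, ?_⟩, rfl⟩
  intro a b
  exact Iff.rfl

theorem RootedIso.ball_mono {X Y : RootedGraph} {r R : ℕ} (hrR : r ≤ R)
    (h : RootedIso (X.ball R) (Y.ball R)) : RootedIso (X.ball r) (Y.ball r) :=
  ((X.ball_ball hrR).symm.trans (h.ball r)).trans (Y.ball_ball hrR)

theorem RootedIso.ball_zero (X Y : RootedGraph) : RootedIso (X.ball 0) (Y.ball 0) := by
  have key : ∀ (Z : RootedGraph) (a : (Z.ball 0).V), a = (Z.ball 0).root := by
    rintro Z ⟨a, ha⟩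
    obtain ⟨p, hp⟩ := mem_ballSet_iff.1 ha
    exact Subtype.ext (SimpleGraph.Walk.eq_of_length_eq_zero (Nat.le_zero.1 hp)).symm
  refine ⟨⟨⟨fun _ => (Y.ball 0).root, fun _ => (X.ball 0).root,
    fun a => (key X a).symm, fun a => (key Y a).symm⟩, ?_⟩, rfl⟩
  intro a b
  rw [key X a, key X b]
  exact iff_of_false (SimpleGraph.irrefl _) (SimpleGraph.irrefl _)

/-- The local distance `2 ^ (-R)`, where `R` is the largest radius at which the balls around the
roots are isomorphic as rooted graphs; it is `0` if they are isomorphic at all radii. -/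
def dloc (X Y : RootedGraph) : ℝ :=
  ⨅ R : {R : ℕ // RootedIso (X.ball R) (Y.ball R)}, (1 / 2 : ℝ) ^ R.1

/-- The (pseudo)metric of local convergence.  Isomorphic rooted graphs are at distance `0`, so
continuous functions and Borel sets only depend on graphs up to rooted isomorphism: this is the
usual metric on the set of isomorphism classes, pulled back to their representatives. -/
instance : PseudoMetricSpace RootedGraph where
  dist := dloc
  dist_self X := by
    have hbdd : BddBelow (Set.range fun R : {R : ℕ // RootedIso (X.ball R) (X.ball R)} =>
      (1 / 2 : ℝ) ^ R.1) := ⟨0, by rintro _ ⟨R, rfl⟩; positivity⟩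
    refine le_antisymm ?_ (Real.iInf_nonneg fun R => by positivity)
    refine ge_of_tendsto' (tendsto_pow_atTop_nhds_zero_of_lt_one
      (by norm_num : (0 : ℝ) ≤ 1 / 2) (by norm_num)) fun n => ?_
    exact ciInf_le hbdd ⟨n, RootedIso.refl _⟩
  dist_comm X Y := by
    have h : ∀ X Y : RootedGraph, dloc X Y ≤ dloc Y X := by
      intro X Y
      have : Nonempty {R : ℕ // RootedIso (Y.ball R) (X.ball R)} := ⟨⟨0, RootedIso.ball_zero _ _⟩⟩
      refine le_ciInf fun R => ?_
      exact ciInf_le (f := fun R : {R : ℕ // RootedIso (X.ball R) (Y.ball R)} =>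
        (1 / 2 : ℝ) ^ R.1) ⟨0, by rintro _ ⟨R, rfl⟩; positivity⟩ ⟨R.1, R.2.symm⟩
    exact le_antisymm (h X Y) (h Y X)
  dist_triangle X Y Z := by
    have : Nonempty {R : ℕ // RootedIso (X.ball R) (Y.ball R)} := ⟨⟨0, RootedIso.ball_zero _ _⟩⟩
    have : Nonempty {R : ℕ // RootedIso (Y.ball R) (Z.ball R)} := ⟨⟨0, RootedIso.ball_zero _ _⟩⟩
    refine le_ciInf_add_ciInf fun R S => ?_
    have hmin : RootedIso (X.ball (min R.1 S.1)) (Z.ball (min R.1 S.1)) :=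
      (R.2.ball_mono (min_le_left _ _)).trans (S.2.ball_mono (min_le_right _ _))
    refine (ciInf_le (f := fun R : {R : ℕ // RootedIso (X.ball R) (Z.ball R)} =>
        (1 / 2 : ℝ) ^ R.1) ⟨0, by rintro _ ⟨R, rfl⟩; positivity⟩ ⟨_, hmin⟩).trans ?_
    have h1 : (0 : ℝ) < (1 / 2 : ℝ) ^ R.1 := by positivity
    have h2 : (0 : ℝ) < (1 / 2 : ℝ) ^ S.1 := by positivity
    rcases min_choice R.1 S.1 with h | h <;> simp only [h] <;> linarith

instance : MeasurableSpace RootedGraph := borel RootedGraph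

instance : BorelSpace RootedGraph := ⟨rfl⟩

/-! ### Random finite graphs -/

/-- Nonempty finite graphs, up to naming the `m + 1` vertices `0, …, m`.  This type is countable,
and a random finite graph is given by its law, a `PMF FinGraph`. -/
abbrev FinGraph : Type := Σ m : ℕ, SimpleGraph (Fin (m + 1))

/-- The number of vertices. -/
def FinGraph.order (G : FinGraph) : ℕ := G.1 + 1

/-- The ball of radius `r` around the vertex `v` of a finite graph. -/
def FinGraph.ball (G : FinGraph) (v : Fin (G.1 + 1)) (r : ℕ) : RootedGraph :=
  ballAt G.2 (fun _ => Set.toFinite _) v r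

/-- `E[f(B_G(v, r))]` for a fixed finite graph `G` and a uniformly random vertex `v` of it. -/
def FinGraph.ballMean (G : FinGraph) (r : ℕ) (f : RootedGraph → ℝ) : ℝ :=
  (∑ v : Fin (G.1 + 1), f (G.ball v r)) / (G.order : ℝ)

/-- Local convergence of a sequence of random finite graphs to a random rooted graph with law `U`:
for every `r`, the law of the ball of radius `r` around a uniformly random vertex of `Gₙ` (the
vertex being random, `Gₙ` being given) converges weakly, in probability with respect to `Gₙ`, to
the law of the ball of radius `r` around the root.  If every `Gₙ` is deterministic, this says that
the ball around a uniformly random vertex converges in distribution. -/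
def ConvergesLocally (G : ℕ → PMF FinGraph) (U : Measure RootedGraph) : Prop :=
  ∀ (r : ℕ) (f : RootedGraph →ᵇ ℝ) (ε : ℝ), 0 < ε →
    Tendsto (fun n => (G n).toOuterMeasure
      {H | ε < |H.ballMean r f - ∫ X, f (X.ball r) ∂U|}) atTop (𝓝 0)

/-- The number of vertices tends to infinity in probability. -/
def OrderTendsto (G : ℕ → PMF FinGraph) : Prop :=
  ∀ k : ℕ, Tendsto (fun n => (G n).toOuterMeasure {H | H.order ≤ k}) atTop (𝓝 0)

/-! ### Path growth -/

/-- The number of paths of length at most `r` that start at `v`. -/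
def pathCount {V : Type*} (G : SimpleGraph V) (v : V) (r : ℕ) : ℕ∞ :=
  Set.encard {p : Σ w, G.Walk v w | p.2.IsPath ∧ p.2.length ≤ r}

/-- `E[min(N(r), M)]`, where `N(r)` is the number of paths of length at most `r` that start at a
uniformly random vertex of the random finite graph with law `P`. -/
def truncPathMean (P : PMF FinGraph) (r M : ℕ) : ℝ≥0∞ :=
  ∑' H : FinGraph, P H *
    ((∑ v : Fin (H.1 + 1), ((min (pathCount H.2 v r) (M : ℕ∞) : ℕ∞) : ℝ≥0∞)) / (H.order : ℝ≥0∞))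

/-- `lim_{M → ∞} limsup_{n → ∞} E[min(N_{Gₙ}(r), M)]`; the limit is that of a monotone function of
`M`, hence a supremum. -/
def muStar (G : ℕ → PMF FinGraph) (r : ℕ) : ℝ≥0∞ :=
  ⨆ M : ℕ, limsup (fun n => truncPathMean (G n) r M) atTop

theorem tendsto_muStar (G : ℕ → PMF FinGraph) (r : ℕ) :
    Tendsto (fun M : ℕ => limsup (fun n => truncPathMean (G n) r M) atTop) atTop
      (𝓝 (muStar G r)) := by
  refine tendsto_atTop_iSup fun M N hMN => ?_
  refine limsup_le_limsup (Eventually.of_forall fun n => ?_)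
  refine ENNReal.tsum_le_tsum fun H => ?_
  have h : (M : ℕ∞) ≤ N := by exact_mod_cast hMN
  gcongr

/-- Subfactorial path growth. -/
def SubfactorialPathGrowth (G : ℕ → PMF FinGraph) : Prop :=
  Tendsto (fun r : ℕ => muStar G r / (r.factorial : ℝ≥0∞)) atTop (𝓝 0)

/-! ### The greedy maximal independent set -/

open Classical in
/-- The greedy independent set: inspect the vertices in the order of the list, and add a vertex if
it has no neighbour among the vertices added so far. -/
def greedySet {V : Type*} (G : SimpleGraph V) (l : List V) : Finset V :=
  l.foldl (fun I v => if ∀ w ∈ I, ¬ G.Adj v w then insert v I else I) ∅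

/-- The density of the greedy independent set of a finite graph, the vertices being inspected in
the order `π 0, π 1, …, π m`. -/
def greedyRatio (G : FinGraph) (π : Equiv.Perm (Fin (G.1 + 1))) : ℝ :=
  ((greedySet G.2 (List.ofFn π)).card : ℝ) / (G.order : ℝ)

/-- The law of the greedy independence ratio of a random finite graph, the vertices being inspected
in a uniformly random order. -/
def greedyRatioLaw (P : PMF FinGraph) : PMF ℝ :=
  P.bind fun G => (PMF.uniformOfFintype (Equiv.Perm (Fin (G.1 + 1)))).map (greedyRatio G)

/-- The law of independent labels, one for every vertex, uniform in `[0, 1]`. -/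
def labelLaw (V : Type*) : Measure (V → unitInterval) :=
  Measure.infinitePi fun _ => (volume : Measure unitInterval)

/-- The past of `v`: the vertices that are reachable from `v` by a path with decreasing labels. -/
def past {V : Type*} (G : SimpleGraph V) (σ : V → unitInterval) (v : V) : Set V :=
  {w | Relation.ReflTransGen (fun a b => G.Adj a b ∧ σ b < σ a) v w}

/-- The past of the root is almost surely finite. -/
def NonexplosiveGrowth (U : Measure RootedGraph) : Prop :=
  ∀ᵐ X ∂U, ∀ᵐ σ ∂(labelLaw X.V), (past X.graph σ X.root).Finite

/-- The past of the root is finite, and the root belongs to the greedy independent set of the graph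
induced on its past, whose vertices are inspected in increasing order of their labels. -/
def RootOccupied (X : RootedGraph) (σ : X.V → unitInterval) : Prop :=
  ∃ l : List (past X.graph σ X.root), (∀ v, v ∈ l) ∧ l.Pairwise (fun a b => σ a.1 < σ b.1) ∧
    ⟨X.root, Relation.ReflTransGen.refl⟩ ∈ greedySet (X.graph.induce (past X.graph σ X.root)) l

/-- The probability `ι(U, ρ)` that the root is in the greedy independent set of its past. -/
def rootDensity (U : Measure RootedGraph) : ℝ :=
  (∫⁻ X, labelLaw X.V {σ | RootOccupied X σ} ∂U).toReal

end GreedyMIS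

end

noncomputable section

namespace GreedyMIS

/-! ### Independent uniform labels -/

/-! Ordering vertices by i.i.d. uniform labels produces a uniformly random order, and then a vertex
is chosen exactly when no neighbour with a smaller label is. Unrolling this recursion to depth `r`
gives a rule, `Occupied`, that depends only on the ball of radius `r`. It agrees with the greedy set
at `v` unless a decreasing path of length `r` starts at `v` (`mem_greedySet_iff_occupied`,
`rootOccupied_iff`).

Such paths are rare: the labels decrease along a fixed path with `r` edges with probability
`1/(r+1)!`, so a union bound gives at most `min(N(r), r!)/r!` (`labelLaw_hasDecreasingPath_le`).
Subfactorial growth makes the average of this bound small for a suitable `r`, and local convergence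
carries the estimate to the limit (`exists_integral_decreasingProb_le`). An infinite past in a
locally finite graph forces decreasing paths of every length, hence nonexplosive growth.

For the density, the mean number of occupied vertices per vertex converges because it averages a
local function. It concentrates by Chebyshev's inequality: occupations at vertices with disjoint
`r`-balls are independent, and few balls of radius `2r` are large, since the limit is locally finite
(`variance_sum_occupiedInd_le`). Markov's inequality bounds the vertices where truncated and true
rules differ. Finally `ι(U, ρ) > 0`, because the root may have the smallest label among its
neighbours, so an additive error is also a relative one. -/

instance (V : Type*) : IsProbabilityMeasure (labelLaw V) := by
  unfold labelLaw; infer_instance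

theorem measurable_comp_label {V W : Type*} (q : W → V) :
    Measurable (fun σ : V → unitInterval => σ ∘ q) :=
  measurable_pi_lambda _ fun i => measurable_pi_apply (q i)

/-- Reading independent labels along an injective map gives independent labels. -/
theorem labelLaw_map_comp {V W : Type*} (q : W → V) (hq : Function.Injective q) :
    (labelLaw V).map (fun σ => σ ∘ q) = labelLaw W := by
  classical
  refine Measure.eq_infinitePi _ fun s t ht => ?_
  rw [Measure.map_apply (measurable_comp_label q) (MeasurableSet.pi s.countable_toSet
    fun i _ => ht i)]
  -- The preimage of a box is a box over the image of `s`; by injectivity the chosen preimage of `q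
  -- w` is `w`, and coordinates off the range of `q` are unrestricted.
  have hpre : (fun σ : V → unitInterval => σ ∘ q) ⁻¹' ((s : Set W).pi t) =
      ((s.map ⟨q, hq⟩ : Finset V) : Set V).pi
        (fun v => if h : ∃ w, q w = v then t h.choose else Set.univ) := by
    ext σ
    simp only [Set.mem_preimage, Set.mem_pi, Finset.mem_coe, Finset.mem_map,
      Function.Embedding.coeFn_mk, forall_exists_index, and_imp, forall_apply_eq_imp_iff₂]
    refine forall₂_congr fun w _ => ?_
    have h : ∃ w', q w' = q w := ⟨w, rfl⟩
    rw [dif_pos h, hq h.choose_spec]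
    rfl
  rw [hpre, labelLaw, Measure.infinitePi_pi, Finset.prod_map]
  · refine Finset.prod_congr rfl fun w _ => ?_
    have h : ∃ w', q w' = q w := ⟨w, rfl⟩
    simp only [Function.Embedding.coeFn_mk]
    rw [dif_pos h, hq h.choose_spec]
  · intro v _
    split_ifs
    · exact ht _
    · exact MeasurableSet.univ

theorem labelLaw_preimage_comp {V W : Type*} (q : W → V) (hq : Function.Injective q)
    {A : Set (W → unitInterval)} (hA : MeasurableSet A) :
    labelLaw V {σ | σ ∘ q ∈ A} = labelLaw W A := by
  rw [← labelLaw_map_comp q hq, Measure.map_apply (measurable_comp_label q) hA]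
  rfl

/-- The joint law of two distinct labels is a product of atomless measures, so the diagonal is null
by Fubini. -/
theorem labelLaw_tie {V : Type*} {v w : V} (hvw : v ≠ w) :
    labelLaw V {σ | σ v = σ w} = 0 := by
  have hind : ProbabilityTheory.IndepFun (fun σ : V → unitInterval => σ v) (fun σ => σ w)
      (labelLaw V) :=
    (ProbabilityTheory.iIndepFun_infinitePi (P := fun _ : V => (volume : Measure unitInterval))
      (X := fun _ x => x) fun _ => measurable_id).indepFun hvw
  have hmv : ∀ u : V, Measurable (fun σ : V → unitInterval => σ u) := fun u =>
    measurable_pi_apply u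
  have hmap := (ProbabilityTheory.indepFun_iff_map_prod_eq_prod_map_map
    (hmv v).aemeasurable (hmv w).aemeasurable).1 hind
  have hu : ∀ u : V, (labelLaw V).map (fun σ => σ u) = (volume : Measure unitInterval) := fun u =>
    (measurePreserving_eval_infinitePi (fun _ : V => (volume : Measure unitInterval)) u).map_eq
  rw [hu, hu] at hmap
  have hdiag : MeasurableSet {x : unitInterval × unitInterval | x.1 = x.2} :=
    measurableSet_eq_fun measurable_fst measurable_snd
  have h0 : (labelLaw V).map (fun σ => (σ v, σ w)) {x | x.1 = x.2} = 0 := by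
    rw [hmap, Measure.measure_prod_null hdiag]
    refine Eventually.of_forall fun x => ?_
    have : Prod.mk x ⁻¹' {x : unitInterval × unitInterval | x.1 = x.2} = {x} := by
      ext y; simp [eq_comm]
    simp [this]
  rwa [Measure.map_apply ((hmv v).prodMk (hmv w)) hdiag] at h0

theorem ae_injective_label (V : Type*) [Countable V] :
    ∀ᵐ σ ∂(labelLaw V), Function.Injective σ := by
  have h : ∀ᵐ σ ∂(labelLaw V), ∀ v w : V, v ≠ w → σ v ≠ σ w := by
    refine ae_all_iff.2 fun v => ae_all_iff.2 fun w => ?_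
    by_cases hvw : v = w
    · exact Eventually.of_forall fun σ h => absurd hvw h
    · have := labelLaw_tie hvw
      refine (measure_eq_zero_iff_ae_notMem.1 this).mono fun σ hσ _ => hσ
  filter_upwards [h] with σ hσ v w hvw
  by_contra hne
  exact hσ v w hne hvw

theorem measurableSet_strictMono_comp {n : ℕ} {V : Type*} (q : Fin n → V) :
    MeasurableSet {σ : V → unitInterval | StrictMono (σ ∘ q)} := by
  have : {σ : V → unitInterval | StrictMono (σ ∘ q)} =
      ⋂ i, ⋂ j, ⋂ (_ : i < j), {σ | σ (q i) < σ (q j)} := by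
    ext σ; simp [StrictMono]
  rw [this]
  exact MeasurableSet.iInter fun i => MeasurableSet.iInter fun j => MeasurableSet.iInter fun _ =>
    measurableSet_lt (measurable_pi_apply _) (measurable_pi_apply _)

/-- A strictly increasing enumeration is determined by its range, which is that of `σ` for every
permutation; as `σ` is then injective, the permutation can be recovered. -/
theorem disjoint_strictMono_comp {n : ℕ} :
    Pairwise (Function.onFun Disjoint
      fun π : Equiv.Perm (Fin n) => {σ : Fin n → unitInterval | StrictMono (σ ∘ π)}) := by
  intro π τ hne
  refine Set.disjoint_left.2 fun σ hπ hτ => hne ?_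
  have hr : Set.range (σ ∘ π) = Set.range (σ ∘ τ) := by
    rw [Set.range_comp, Set.range_comp, π.range_eq_univ, τ.range_eq_univ]
  have heq : σ ∘ π = σ ∘ τ := (StrictMono.range_inj hπ hτ).1 hr
  have hinj : Function.Injective σ := by
    have := hπ.injective.comp π.symm.injective
    simpa [Function.comp_assoc] using this
  exact Equiv.ext fun i => hinj (congrFun heq i)

/-- The `n!` order events are equally likely by invariance under relabelling, disjoint, and cover
all labellings without ties. -/
theorem labelLaw_strictMono_comp {n : ℕ} (π : Equiv.Perm (Fin n)) :
    labelLaw (Fin n) {σ | StrictMono (σ ∘ π)} = ((n.factorial : ℕ) : ℝ≥0∞)⁻¹ := by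
  have hconst : ∀ τ : Equiv.Perm (Fin n), labelLaw (Fin n) {σ | StrictMono (σ ∘ τ)} =
      labelLaw (Fin n) {σ | StrictMono σ} := fun τ =>
    labelLaw_preimage_comp τ τ.injective (measurableSet_strictMono_comp id)
  have hsum : ∑ τ : Equiv.Perm (Fin n), labelLaw (Fin n) {σ | StrictMono (σ ∘ τ)} = 1 := by
    rw [← tsum_fintype (L := .unconditional _), ← measure_iUnion disjoint_strictMono_comp
      fun τ => measurableSet_strictMono_comp τ]
    refine prob_compl_eq_zero_iff (MeasurableSet.iUnion fun τ : Equiv.Perm (Fin n) =>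
      measurableSet_strictMono_comp τ) |>.1 ?_
    refine measure_mono_null (fun σ hσ => ?_) (ae_iff.1 (ae_injective_label (Fin n)))
    intro hinj
    refine hσ (Set.mem_iUnion.2 ⟨Tuple.sort σ, ?_⟩)
    exact (Tuple.monotone_sort σ).strictMono_of_injective
      (hinj.comp (Tuple.sort σ).injective)
  rw [Finset.sum_congr rfl fun τ _ => hconst τ, Finset.sum_const, Finset.card_univ,
    Fintype.card_perm, Fintype.card_fin, nsmul_eq_mul] at hsum
  rw [hconst]
  exact ENNReal.eq_inv_of_mul_eq_one_left (by rwa [mul_comm] at hsum)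

/-- A property of a uniformly random order is a property of the order of independent labels. -/
theorem uniform_perm_le {n : ℕ} (S : Set (Equiv.Perm (Fin n))) {A : Set (Fin n → unitInterval)}
    (hA : ∀ π ∈ S, ∀ σ : Fin n → unitInterval, StrictMono (σ ∘ π) → σ ∈ A) :
    (PMF.uniformOfFintype (Equiv.Perm (Fin n))).toOuterMeasure S ≤ labelLaw (Fin n) A := by
  classical
  rw [PMF.toOuterMeasure_uniformOfFintype_apply, Fintype.card_perm, Fintype.card_fin]
  -- Each permutation has the mass of its order event. Only these disjoint events must be
  -- measurable, not `A`.
  calc ((Fintype.card S : ℕ) : ℝ≥0∞) / ((n.factorial : ℕ) : ℝ≥0∞)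
      = ∑ π : S, labelLaw (Fin n) {σ | StrictMono (σ ∘ π.1)} := by
        simp only [labelLaw_strictMono_comp]
        rw [Finset.sum_const, Finset.card_univ, nsmul_eq_mul, div_eq_mul_inv]
    _ = labelLaw (Fin n) (⋃ π : S, {σ | StrictMono (σ ∘ π.1)}) := by
        rw [← tsum_fintype (L := .unconditional _), measure_iUnion]
        · intro π τ hne
          exact disjoint_strictMono_comp fun h => hne (Subtype.ext h)
        · exact fun π => measurableSet_strictMono_comp _
    _ ≤ labelLaw (Fin n) A := by
        refine measure_mono fun σ hσ => ?_
        obtain ⟨π, hπ⟩ := Set.mem_iUnion.1 hσ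
        exact hA π.1 π.2 σ hπ

/-- The labels decrease along a given list of distinct vertices with probability `1 / k!`. -/
theorem labelLaw_decreasing_list {V : Type*} {l : List V} (hl : l.Nodup) :
    labelLaw V {σ | l.Pairwise fun a b => σ b < σ a} = ((l.length.factorial : ℕ) : ℝ≥0∞)⁻¹ := by
  -- Reading the list backwards turns decreasing labels into increasing ones.
  have hq : Function.Injective fun i : Fin l.length => l.get i.rev :=
    (List.nodup_iff_injective_get.1 hl).comp Fin.rev_injective
  rw [← labelLaw_strictMono_comp (1 : Equiv.Perm (Fin l.length)),
    ← labelLaw_preimage_comp _ hq (measurableSet_strictMono_comp _)]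
  congr 1
  ext σ
  simp only [Set.mem_ofPred_eq, List.pairwise_iff_get, Equiv.Perm.coe_one, Function.comp_id]
  constructor
  · intro h i j hij
    exact h _ _ (Fin.rev_lt_rev.2 hij)
  · intro h i j hij
    simpa only [Function.comp_apply, Fin.rev_rev] using h (Fin.rev_lt_rev.2 hij)

/-! ### Decreasing paths and the greedy rule, truncated at a given depth -/

/-- There is a path of length `k` from `v` along which the labels decrease. -/
def HasDecreasingPath {V : Type*} (G : SimpleGraph V) (σ : V → unitInterval) : ℕ → V → Prop
  | 0, _ => True
  | k + 1, v => ∃ w, G.Adj v w ∧ σ w < σ v ∧ HasDecreasingPath G σ k w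

/-- The recursive greedy rule, cut off at depth `k`: a vertex is occupied if no neighbour with a
smaller label is. -/
def Occupied {V : Type*} (G : SimpleGraph V) (σ : V → unitInterval) : ℕ → V → Prop
  | 0, _ => True
  | k + 1, v => ∀ w, G.Adj v w → σ w < σ v → ¬ Occupied G σ k w

theorem HasDecreasingPath.of_succ {V : Type*} {G : SimpleGraph V} {σ : V → unitInterval} {k : ℕ}
    {v : V} (h : HasDecreasingPath G σ (k + 1) v) : HasDecreasingPath G σ k v := by
  induction k generalizing v with
  | zero => trivial
  | succ k ih =>
    obtain ⟨w, hvw, hσ, hw⟩ := h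
    exact ⟨w, hvw, hσ, ih hw⟩

theorem measurableSet_hasDecreasingPath {V : Type*} [Countable V] (G : SimpleGraph V) (k : ℕ)
    (v : V) : MeasurableSet {σ | HasDecreasingPath G σ k v} := by
  induction k generalizing v with
  | zero => exact MeasurableSet.univ
  | succ k ih =>
    have : {σ | HasDecreasingPath G σ (k + 1) v} =
        ⋃ w, ⋃ (_ : G.Adj v w), {σ | σ w < σ v} ∩ {σ | HasDecreasingPath G σ k w} := by
      ext σ
      simp only [HasDecreasingPath, Set.mem_ofPred_eq, Set.mem_iUnion, Set.mem_inter_iff,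
        exists_prop]
    rw [this]
    exact MeasurableSet.iUnion fun w => MeasurableSet.iUnion fun _ =>
      (measurableSet_lt (measurable_pi_apply w) (measurable_pi_apply v)).inter (ih w)

theorem measurableSet_occupied {V : Type*} [Countable V] (G : SimpleGraph V) (k : ℕ)
    (v : V) : MeasurableSet {σ | Occupied G σ k v} := by
  induction k generalizing v with
  | zero => exact MeasurableSet.univ
  | succ k ih =>
    have : {σ | Occupied G σ (k + 1) v} =
        ⋂ w, ⋂ (_ : G.Adj v w), ({σ | σ w < σ v} ∩ {σ | Occupied G σ k w})ᶜ := by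
      ext σ
      simp only [Occupied, Set.mem_ofPred_eq, Set.mem_iInter, Set.mem_inter_iff,
        Set.mem_compl_iff, not_and]
    rw [this]
    exact MeasurableSet.iInter fun w => MeasurableSet.iInter fun _ =>
      ((measurableSet_lt (measurable_pi_apply w) (measurable_pi_apply v)).inter (ih w)).compl

/-! ### Locality and invariance -/

theorem self_mem_of_ballSet_subset {V : Type*} {G : SimpleGraph V} {v : V} {k : ℕ} {s : Set V}
    (hs : ballSet G v k ⊆ s) : v ∈ s := hs (self_mem_ballSet G v k)

theorem ballSet_subset_of_adj {V : Type*} {G : SimpleGraph V} {v w : V} (h : G.Adj v w) (k : ℕ) :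
    ballSet G w k ⊆ ballSet G v (k + 1) := by
  intro x hx
  obtain ⟨p, hp⟩ := mem_ballSet_iff.1 hx
  exact mem_ballSet_iff.2 ⟨p.cons h, by simpa using hp⟩

/-- Each step to a neighbour uses up one unit of depth and one of radius, so the recursion never
leaves the ball. -/
theorem hasDecreasingPath_induce {V : Type*} {G : SimpleGraph V} {σ : V → unitInterval} {k : ℕ}
    {v : V} {s : Set V} (hs : ballSet G v k ⊆ s) (hv : v ∈ s) :
    HasDecreasingPath (G.induce s) (σ ∘ Subtype.val) k ⟨v, hv⟩ ↔ HasDecreasingPath G σ k v := by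
  induction k generalizing v with
  | zero => exact Iff.rfl
  | succ k ih =>
    constructor
    · rintro ⟨⟨w, hw⟩, hvw, hσ, h⟩
      exact ⟨w, hvw, hσ,
        (ih ((ballSet_subset_of_adj (SimpleGraph.induce_adj.1 hvw) k).trans hs) hw).1 h⟩
    · rintro ⟨w, hvw, hσ, h⟩
      have hsub := (ballSet_subset_of_adj hvw k).trans hs
      exact ⟨⟨w, self_mem_of_ballSet_subset hsub⟩, hvw, hσ, (ih hsub _).2 h⟩

theorem occupied_induce {V : Type*} {G : SimpleGraph V} {σ : V → unitInterval} {k : ℕ}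
    {v : V} {s : Set V} (hs : ballSet G v k ⊆ s) (hv : v ∈ s) :
    Occupied (G.induce s) (σ ∘ Subtype.val) k ⟨v, hv⟩ ↔ Occupied G σ k v := by
  induction k generalizing v with
  | zero => exact Iff.rfl
  | succ k ih =>
    constructor
    · intro h w hvw hσ ho
      have hsub := (ballSet_subset_of_adj hvw k).trans hs
      exact h ⟨w, self_mem_of_ballSet_subset hsub⟩ hvw hσ ((ih hsub _).2 ho)
    · rintro h ⟨w, hw⟩ hvw hσ ho
      exact h w hvw hσ
        ((ih ((ballSet_subset_of_adj (SimpleGraph.induce_adj.1 hvw) k).trans hs) hw).1 ho)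

theorem hasDecreasingPath_iso {V W : Type*} {G : SimpleGraph V} {H : SimpleGraph W} (e : G ≃g H)
    {σ : W → unitInterval} {k : ℕ} {v : V} :
    HasDecreasingPath G (σ ∘ e) k v ↔ HasDecreasingPath H σ k (e v) := by
  induction k generalizing v with
  | zero => exact Iff.rfl
  | succ k ih =>
    constructor
    · rintro ⟨w, hvw, hσ, h⟩
      exact ⟨e w, e.map_adj_iff.2 hvw, hσ, ih.1 h⟩
    · rintro ⟨w, hvw, hσ, h⟩
      obtain ⟨w, rfl⟩ := e.surjective w
      exact ⟨w, e.map_adj_iff.1 hvw, hσ, ih.2 h⟩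

theorem occupied_iso {V W : Type*} {G : SimpleGraph V} {H : SimpleGraph W} (e : G ≃g H)
    {σ : W → unitInterval} {k : ℕ} {v : V} :
    Occupied G (σ ∘ e) k v ↔ Occupied H σ k (e v) := by
  induction k generalizing v with
  | zero => exact Iff.rfl
  | succ k ih =>
    constructor
    · intro h w hvw hσ ho
      obtain ⟨w, rfl⟩ := e.surjective w
      exact h w (e.map_adj_iff.1 hvw) hσ (ih.2 ho)
    · intro h w hvw hσ ho
      exact h (e w) (e.map_adj_iff.2 hvw) hσ (ih.1 ho)

/-- The probability that a decreasing path of length `k` starts at `v`. -/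
def decreasingProb {V : Type*} (G : SimpleGraph V) (k : ℕ) (v : V) : ℝ :=
  (labelLaw V).real {σ | HasDecreasingPath G σ k v}

/-- The probability that `v` is occupied according to the greedy rule cut off at depth `k`. -/
def occupiedProb {V : Type*} (G : SimpleGraph V) (k : ℕ) (v : V) : ℝ :=
  (labelLaw V).real {σ | Occupied G σ k v}

theorem decreasingProb_induce_ballSet {V : Type*} [Countable V] (G : SimpleGraph V) (k : ℕ)
    (v : V) :
    decreasingProb (G.induce (ballSet G v k)) k ⟨v, self_mem_ballSet G v k⟩ =
      decreasingProb G k v := by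
  rw [decreasingProb, measureReal_def, ← labelLaw_preimage_comp (Subtype.val)
    Subtype.val_injective (measurableSet_hasDecreasingPath _ _ _)]
  simp only [Set.mem_ofPred_eq, hasDecreasingPath_induce subset_rfl]
  rfl

theorem occupiedProb_induce_ballSet {V : Type*} [Countable V] (G : SimpleGraph V) (k : ℕ)
    (v : V) :
    occupiedProb (G.induce (ballSet G v k)) k ⟨v, self_mem_ballSet G v k⟩ =
      occupiedProb G k v := by
  rw [occupiedProb, measureReal_def, ← labelLaw_preimage_comp (Subtype.val)
    Subtype.val_injective (measurableSet_occupied _ _ _)]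
  simp only [Set.mem_ofPred_eq, occupied_induce subset_rfl]
  rfl

theorem decreasingProb_iso {V W : Type*} [Countable V] {G : SimpleGraph V} {H : SimpleGraph W}
    (e : G ≃g H) (k : ℕ) (v : V) : decreasingProb G k v = decreasingProb H k (e v) := by
  rw [decreasingProb, measureReal_def, ← labelLaw_preimage_comp e
    e.injective (measurableSet_hasDecreasingPath _ _ _)]
  simp only [Set.mem_ofPred_eq, hasDecreasingPath_iso]
  rfl

theorem occupiedProb_iso {V W : Type*} [Countable V] {G : SimpleGraph V} {H : SimpleGraph W}
    (e : G ≃g H) (k : ℕ) (v : V) : occupiedProb G k v = occupiedProb H k (e v) := by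
  rw [occupiedProb, measureReal_def, ← labelLaw_preimage_comp e
    e.injective (measurableSet_occupied _ _ _)]
  simp only [Set.mem_ofPred_eq, occupied_iso]
  rfl

/-! ### The greedy independent set -/

theorem mem_greedySet_append_singleton {V : Type*} (G : SimpleGraph V) (l : List V)
    (x v : V) : v ∈ greedySet G (l ++ [x]) ↔
      v ∈ greedySet G l ∨ v = x ∧ ∀ w ∈ greedySet G l, ¬ G.Adj x w := by
  classical
  have h : greedySet G (l ++ [x]) = if ∀ w ∈ greedySet G l, ¬ G.Adj x w then
      insert x (greedySet G l) else greedySet G l := by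
    simp only [greedySet, List.foldl_append, List.foldl_cons, List.foldl_nil]
    congr
  rw [h]
  split_ifs with hc
  · simp only [Finset.mem_insert]
    tauto
  · tauto

/-- Induction on the last vertex: its label is the largest, so it enters no condition of an earlier
vertex, while its own condition runs over all vertices chosen before it. -/
theorem greedySet_of_pairwise_lt {V : Type*} {G : SimpleGraph V} {σ : V → unitInterval} (l : List V)
    (hl : l.Pairwise fun a b => σ a < σ b) :
    (∀ v ∈ greedySet G l, v ∈ l) ∧ ∀ v ∈ l, (v ∈ greedySet G l ↔
      ∀ w ∈ l, G.Adj v w → σ w < σ v → w ∉ greedySet G l) := by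
  classical
  induction l using List.reverseRecOn with
  | nil => simp [greedySet]
  | append_singleton l x ih =>
    rw [List.pairwise_append] at hl
    obtain ⟨hl, -, hx⟩ := hl
    replace hx : ∀ a ∈ l, σ a < σ x := fun a ha => hx a ha x (by simp)
    obtain ⟨ih1, ih2⟩ := ih hl
    have hxl : x ∉ l := fun h => lt_irrefl _ (hx x h)
    refine ⟨fun v hv => ?_, fun v hv => ?_⟩
    · rw [mem_greedySet_append_singleton] at hv
      rcases hv with hv | ⟨rfl, -⟩
      · exact List.mem_append_left _ (ih1 v hv)
      · simp
    · simp only [mem_greedySet_append_singleton, List.mem_append, List.mem_singleton] at hv ⊢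
      rcases hv with hv | rfl
      · have hne : v ≠ x := fun h => hxl (h ▸ hv)
        simp only [hne, false_and, or_false]
        rw [ih2 v hv]
        constructor
        · rintro h w (hw | rfl) hvw hσ
          · have hwx : w ≠ x := fun h => hxl (h ▸ hw)
            simpa [hwx] using h w hw hvw hσ
          · exact absurd hσ (hx v hv).not_gt
        · intro h w hw hvw hσ hg
          exact h w (Or.inl hw) hvw hσ (Or.inl hg)
      · have hng : v ∉ greedySet G l := fun h => hxl (ih1 v h)
        simp only [hng, false_or, true_and]
        constructor
        · rintro h w (hw | rfl) hvw hσ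
          · have hwx : w ≠ v := fun h => hxl (h ▸ hw)
            simp only [hwx, false_and, or_false]
            exact fun hg => h w hg hvw
          · exact absurd hσ (lt_irrefl _)
        · intro h w hg hvw
          exact h w (Or.inl (ih1 w hg)) hvw (hx w (ih1 w hg)) (Or.inl hg)

/-- If all vertices are inspected in increasing order of their labels, a vertex is chosen if and
only if no neighbour with a smaller label is chosen. -/
theorem mem_greedySet_iff {V : Type*} {G : SimpleGraph V} {σ : V → unitInterval} {l : List V}
    (hall : ∀ v, v ∈ l) (hl : l.Pairwise fun a b => σ a < σ b) (v : V) :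
    v ∈ greedySet G l ↔ ∀ w, G.Adj v w → σ w < σ v → w ∉ greedySet G l := by
  rw [(greedySet_of_pairwise_lt l hl).2 v (hall v)]
  exact ⟨fun h w => h w (hall w), fun h w _ => h w⟩

/-- Both sides obey the same recursion along decreasing steps. Without a decreasing path of length
`k` the recursion ends before depth `0`, so the default value `True` there is never used. -/
theorem mem_greedySet_iff_occupied {V : Type*} {G : SimpleGraph V} {σ : V → unitInterval}
    {l : List V} (hall : ∀ v, v ∈ l) (hl : l.Pairwise fun a b => σ a < σ b) {k : ℕ} {v : V}
    (h : ¬ HasDecreasingPath G σ k v) : v ∈ greedySet G l ↔ Occupied G σ k v := by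
  induction k generalizing v with
  | zero => exact absurd trivial h
  | succ k ih =>
    rw [mem_greedySet_iff hall hl]
    refine forall_congr' fun w => forall₂_congr fun hvw hσ => not_congr (ih fun hw => ?_)
    exact h ⟨w, hvw, hσ, hw⟩

theorem mem_past_of_adj {V : Type*} {G : SimpleGraph V} {σ : V → unitInterval} {u v w : V}
    (hv : v ∈ past G σ u) (hvw : G.Adj v w) (hσ : σ w < σ v) : w ∈ past G σ u :=
  Relation.ReflTransGen.tail hv ⟨hvw, hσ⟩

/-- The past is closed under decreasing steps, the only steps that the recursion takes. -/
theorem hasDecreasingPath_induce_past {V : Type*} {G : SimpleGraph V} {σ : V → unitInterval}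
    {u : V} {k : ℕ} {v : V} (hv : v ∈ past G σ u) :
    HasDecreasingPath (G.induce (past G σ u)) (σ ∘ Subtype.val) k ⟨v, hv⟩ ↔
      HasDecreasingPath G σ k v := by
  induction k generalizing v with
  | zero => exact Iff.rfl
  | succ k ih =>
    constructor
    · rintro ⟨⟨w, hw⟩, hvw, hσ, h⟩
      exact ⟨w, hvw, hσ, (ih hw).1 h⟩
    · rintro ⟨w, hvw, hσ, h⟩
      exact ⟨⟨w, mem_past_of_adj hv hvw hσ⟩, hvw, hσ, (ih _).2 h⟩

theorem occupied_induce_past {V : Type*} {G : SimpleGraph V} {σ : V → unitInterval}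
    {u : V} {k : ℕ} {v : V} (hv : v ∈ past G σ u) :
    Occupied (G.induce (past G σ u)) (σ ∘ Subtype.val) k ⟨v, hv⟩ ↔ Occupied G σ k v := by
  induction k generalizing v with
  | zero => exact Iff.rfl
  | succ k ih =>
    constructor
    · intro h w hvw hσ ho
      exact h ⟨w, mem_past_of_adj hv hvw hσ⟩ hvw hσ ((ih _).2 ho)
    · rintro h ⟨w, hw⟩ hvw hσ ho
      exact h w hvw hσ ((ih hw).1 ho)

/-! ### The past of a vertex -/

theorem ballSet_finite {V : Type*} {G : SimpleGraph V} (hG : ∀ w, (G.neighborSet w).Finite) (v : V)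
    (r : ℕ) : (ballSet G v r).Finite := by
  induction r generalizing v with
  | zero =>
    refine (Set.finite_singleton v).subset fun w hw => ?_
    obtain ⟨p, hp⟩ := mem_ballSet_iff.1 hw
    exact (SimpleGraph.Walk.eq_of_length_eq_zero (Nat.le_zero.1 hp)).symm
  | succ r ih =>
    refine ((Set.finite_singleton v).union ((hG v).biUnion fun w _ => ih w)).subset fun x hx => ?_
    obtain ⟨p, hp⟩ := mem_ballSet_iff.1 hx
    cases p with
    | nil => exact Or.inl rfl
    | cons h p =>
      exact Or.inr (Set.mem_biUnion h (mem_ballSet_iff.2 ⟨p, by simpa using hp⟩))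

/-- By connectedness the finite balls around the root exhaust the graph. Countability gives
measurability of the label events and almost sure absence of ties. -/
theorem RootedGraph.countable (X : RootedGraph) : Countable X.V := by
  rw [← Set.countable_univ_iff]
  refine (Set.countable_iUnion fun r : ℕ =>
    (ballSet_finite X.locallyFinite X.root r).countable).mono fun v _ => ?_
  obtain ⟨p⟩ := X.connected.preconnected X.root v
  exact Set.mem_iUnion.2 ⟨p.length, mem_ballSet_iff.2 ⟨p, le_rfl⟩⟩

theorem past_subset_ballSet {V : Type*} {G : SimpleGraph V} {σ : V → unitInterval} {k : ℕ} {v : V}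
    (h : ¬ HasDecreasingPath G σ k v) : past G σ v ⊆ ballSet G v k := by
  induction k generalizing v with
  | zero => exact absurd trivial h
  | succ k ih =>
    intro x hx
    rcases Relation.ReflTransGen.cases_head hx with rfl | ⟨w, ⟨hvw, hσ⟩, hwx⟩
    · exact self_mem_ballSet _ _ _
    · exact ballSet_subset_of_adj hvw k (ih (fun hw => h ⟨w, hvw, hσ, hw⟩) hwx)

/-- Any increasing enumeration of the past yields the truncated rule's answer, so the choice of list
is immaterial. One exists because the past lies in a finite ball and has no ties. -/
theorem rootOccupied_iff {X : RootedGraph} {σ : X.V → unitInterval} {k : ℕ}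
    (hσ : Function.Injective σ) (h : ¬ HasDecreasingPath X.graph σ k X.root) :
    RootOccupied X σ ↔ Occupied X.graph σ k X.root := by
  have hroot : X.root ∈ past X.graph σ X.root := Relation.ReflTransGen.refl
  have key : ∀ l : List (past X.graph σ X.root), (∀ v, v ∈ l) →
      l.Pairwise (fun a b => σ a.1 < σ b.1) →
      (⟨X.root, hroot⟩ ∈ greedySet (X.graph.induce (past X.graph σ X.root)) l ↔
        Occupied X.graph σ k X.root) := fun l hall hl => by
    rw [mem_greedySet_iff_occupied (σ := σ ∘ Subtype.val) hall hl
      (mt (hasDecreasingPath_induce_past hroot).1 h), occupied_induce_past]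
  constructor
  · rintro ⟨l, hall, hl, hmem⟩
    exact (key l hall hl).1 hmem
  · intro ho
    have hfin : (past X.graph σ X.root).Finite :=
      (ballSet_finite X.locallyFinite X.root k).subset (past_subset_ballSet h)
    have : Fintype (past X.graph σ X.root) := hfin.fintype
    let f : past X.graph σ X.root → unitInterval := fun v => σ v.1
    have hf : Function.Injective f := hσ.comp Subtype.val_injective
    let : LinearOrder (past X.graph σ X.root) := LinearOrder.lift' f hf
    refine ⟨Finset.univ.sort (· ≤ ·), fun v => by simp, ?_, ?_⟩
    · exact Finset.sortedLT_sort _ |>.pairwise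
    · exact (key _ (fun v => by simp) (Finset.sortedLT_sort _ |>.pairwise)).2 ho

/-- The root is occupied if its label is smaller than those of its neighbours. -/
theorem rootOccupied_of_lt {X : RootedGraph} {σ : X.V → unitInterval}
    (hσ : Function.Injective σ) (h : ∀ w, X.graph.Adj X.root w → σ X.root < σ w) :
    RootOccupied X σ :=
  -- Depth `1` suffices: no decreasing step leaves the root, so the rule holds vacuously.
  (rootOccupied_iff (k := 1) hσ fun ⟨w, hw, hlt, _⟩ => hlt.not_gt (h w hw)).2
    fun w hw hlt => absurd hlt (h w hw).not_gt

/-! ### Counting decreasing paths -/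

/-- All later labels lie below the starting one, so a decreasing walk cannot revisit a vertex. -/
theorem HasDecreasingPath.exists_path {V : Type*} {G : SimpleGraph V} {σ : V → unitInterval} {k : ℕ}
    {v : V} (h : HasDecreasingPath G σ k v) : ∃ p : Σ w, G.Walk v w, p.2.IsPath ∧
      p.2.length = k ∧ p.2.support.Pairwise fun a b => σ b < σ a := by
  induction k generalizing v with
  | zero => exact ⟨⟨v, SimpleGraph.Walk.nil⟩, by simp⟩
  | succ k ih =>
    obtain ⟨w, hvw, hσ, hw⟩ := h
    obtain ⟨⟨x, p⟩, hp, hlen, hdec⟩ := ih hw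
    have hlt : ∀ u ∈ p.support, σ u < σ v := by
      intro u hu
      rw [SimpleGraph.Walk.mem_support_iff] at hu
      rcases hu with rfl | hu
      · exact hσ
      · rw [← SimpleGraph.Walk.cons_tail_support, List.pairwise_cons] at hdec
        exact (hdec.1 u hu).trans hσ
    refine ⟨⟨x, p.cons hvw⟩, ?_, by simpa using hlen, ?_⟩
    · rw [SimpleGraph.Walk.cons_isPath_iff]
      exact ⟨hp, fun hv => lt_irrefl _ (hlt v hv)⟩
    · rw [SimpleGraph.Walk.support_cons, List.pairwise_cons]
      exact ⟨hlt, hdec⟩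

/-- Union bound over paths, combined with the trivial bound `1`. The resulting cutoff at `r!`
matches the truncation level `M = r!` in `muStar`. -/
theorem labelLaw_hasDecreasingPath_le {V : Type*} (G : SimpleGraph V) (r : ℕ) (v : V) :
    labelLaw V {σ | HasDecreasingPath G σ r v} ≤
      ((min (pathCount G v r) ((r.factorial : ℕ) : ℕ∞) : ℕ∞) : ℝ≥0∞) / (r.factorial : ℝ≥0∞) := by
  have hf0 : (r.factorial : ℝ≥0∞) ≠ 0 := by exact_mod_cast r.factorial_ne_zero
  rcases le_total ((r.factorial : ℕ) : ℕ∞) (pathCount G v r) with h | h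
  · rw [min_eq_right h]
    simpa [ENNReal.div_self hf0 (ENNReal.natCast_ne_top _)] using prob_le_one
  rw [min_eq_left h]
  set S : Set (Σ w, G.Walk v w) := {p | p.2.IsPath ∧ p.2.length ≤ r} with hS
  have hfin : S.Finite := Set.encard_lt_top_iff.1 (h.trans_lt (ENat.natCast_lt_top _))
  have : Countable S := hfin.countable.to_subtype
  calc labelLaw V {σ | HasDecreasingPath G σ r v}
      ≤ labelLaw V (⋃ p : S, {σ | p.1.2.length = r ∧
          p.1.2.support.Pairwise fun a b => σ b < σ a}) := by
        refine measure_mono fun σ hσ => ?_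
        obtain ⟨p, hp, hlen, hdec⟩ := HasDecreasingPath.exists_path hσ
        exact Set.mem_iUnion.2 ⟨⟨p, hp, hlen.le⟩, hlen, hdec⟩
    _ ≤ ∑' p : S, labelLaw V {σ | p.1.2.length = r ∧
          p.1.2.support.Pairwise fun a b => σ b < σ a} := measure_iUnion_le _
    _ ≤ ∑' _ : S, (r.factorial : ℝ≥0∞)⁻¹ := by
        refine ENNReal.tsum_le_tsum fun p => ?_
        by_cases hlen : p.1.2.length = r
        · refine (measure_mono fun σ hσ => hσ.2).trans
            ((labelLaw_decreasing_list p.2.1.support_nodup).trans_le ?_)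
          -- A path with `r` edges has `r + 1` vertices; the weaker bound `1/r!` is enough.
          rw [SimpleGraph.Walk.length_support, hlen]
          gcongr
          omega
        · simp [hlen]
    _ = _ := by
        rw [ENNReal.tsum_set_const, div_eq_mul_inv]
        rfl

/-! ### Functions of a ball -/

theorem rootedIso_ball_of_dist_lt {X Y : RootedGraph} {r : ℕ} (h : dist X Y < (1 / 2 : ℝ) ^ r) :
    RootedIso (X.ball r) (Y.ball r) := by
  have : Nonempty {R : ℕ // RootedIso (X.ball R) (Y.ball R)} := ⟨⟨0, RootedIso.ball_zero _ _⟩⟩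
  obtain ⟨R, hR⟩ := exists_lt_of_ciInf_lt (show dloc X Y < (1 / 2 : ℝ) ^ r from h)
  refine R.2.ball_mono (le_of_lt ?_)
  exact (pow_lt_pow_iff_right_of_lt_one₀ (by norm_num : (0 : ℝ) < 1 / 2) (by norm_num)).1 hR

/-- Graphs at distance less than `2⁻ʳ` have isomorphic `r`-balls, so the function is locally
constant. -/
theorem continuous_comp_ball {F : RootedGraph → ℝ} (hF : ∀ X Y, RootedIso X Y → F X = F Y)
    (r : ℕ) : Continuous fun X : RootedGraph => F (X.ball r) := by
  refine continuous_iff_continuousAt.2 fun X => ?_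
  refine (tendsto_const_nhds (x := F (X.ball r))).congr' ?_
  filter_upwards [Metric.ball_mem_nhds X (show (0 : ℝ) < (1 / 2) ^ r by positivity)] with Y hY
  exact (hF _ _ (rootedIso_ball_of_dist_lt hY)).symm

theorem rootedIso_ball_self {X : RootedGraph} {r : ℕ}
    (h : ∀ w, w ∈ ballSet X.graph X.root r) : RootedIso (X.ball r) X :=
  ⟨⟨⟨fun x => x.1, fun x => ⟨x, h x⟩, fun _ => rfl, fun _ => rfl⟩, Iff.rfl⟩, rfl⟩

theorem FinGraph.ball_ball (H : FinGraph) (v : Fin (H.1 + 1)) (r : ℕ) :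
    RootedIso ((H.ball v r).ball r) (H.ball v r) := by
  refine rootedIso_ball_self ?_
  rintro ⟨w, hw⟩
  obtain ⟨p, hp⟩ := mem_ballSet_iff.1 hw
  exact mem_ballSet_iff.2 (exists_walk_induce le_rfl hw p hp)

/-- Local convergence, for functions of a ball that are invariant under isomorphism. -/
theorem ConvergesLocally.tendsto_ballMean {G : ℕ → PMF FinGraph} {U : Measure RootedGraph}
    (hloc : ConvergesLocally G U) {F : RootedGraph → ℝ}
    (hF : ∀ X Y, RootedIso X Y → F X = F Y) (h0 : ∀ X, 0 ≤ F X) (h1 : ∀ X, F X ≤ 1) (r : ℕ)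
    {ε : ℝ} (hε : 0 < ε) :
    Tendsto (fun n => (G n).toOuterMeasure
      {H | ε < |H.ballMean r F - ∫ X, F (X.ball r) ∂U|}) atTop (𝓝 0) := by
  -- `F` itself need not be continuous; composing it with the `r`-ball makes it so and does not
  -- change its value on `r`-balls.
  let f : RootedGraph →ᵇ ℝ := BoundedContinuousFunction.ofNormedAddCommGroup
    (fun X => F (X.ball r)) (continuous_comp_ball hF r) 1 fun X => by
      rw [Real.norm_eq_abs, abs_of_nonneg (h0 _)]; exact h1 _
  have hf : ∀ X, f X = F (X.ball r) := fun _ => rfl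
  have h := hloc r f ε hε
  have hH : ∀ H : FinGraph, H.ballMean r f = H.ballMean r F := fun H => by
    unfold FinGraph.ballMean
    congr 1
    exact Finset.sum_congr rfl fun v _ => (hf _).trans (hF _ _ (H.ball_ball v r))
  have hX : ∀ X : RootedGraph, f (X.ball r) = F (X.ball r) := fun X =>
    (hf _).trans (hF _ _ (X.ball_ball le_rfl))
  simpa only [hH, hX] using h

/-! ### Decreasing paths and occupation in the limit -/

theorem decreasingProb_nonneg {V : Type*} (G : SimpleGraph V) (k : ℕ) (v : V) :
    0 ≤ decreasingProb G k v := measureReal_nonneg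

theorem decreasingProb_le_one {V : Type*} (G : SimpleGraph V) (k : ℕ) (v : V) :
    decreasingProb G k v ≤ 1 := measureReal_le_one

theorem occupiedProb_nonneg {V : Type*} (G : SimpleGraph V) (k : ℕ) (v : V) :
    0 ≤ occupiedProb G k v := measureReal_nonneg

theorem occupiedProb_le_one {V : Type*} (G : SimpleGraph V) (k : ℕ) (v : V) :
    occupiedProb G k v ≤ 1 := measureReal_le_one

theorem decreasingProb_rootedIso (r : ℕ) (X Y : RootedGraph) (h : RootedIso X Y) :
    decreasingProb X.graph r X.root = decreasingProb Y.graph r Y.root := by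
  obtain ⟨e, he⟩ := h
  have := X.countable
  rw [← he, decreasingProb_iso e]

theorem occupiedProb_rootedIso (r : ℕ) (X Y : RootedGraph) (h : RootedIso X Y) :
    occupiedProb X.graph r X.root = occupiedProb Y.graph r Y.root := by
  obtain ⟨e, he⟩ := h
  have := X.countable
  rw [← he, occupiedProb_iso e]

theorem decreasingProb_ball (r : ℕ) (X : RootedGraph) :
    decreasingProb (X.ball r).graph r (X.ball r).root = decreasingProb X.graph r X.root := by
  have := X.countable
  exact decreasingProb_induce_ballSet X.graph r X.root

theorem occupiedProb_ball (r : ℕ) (X : RootedGraph) :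
    occupiedProb (X.ball r).graph r (X.ball r).root = occupiedProb X.graph r X.root := by
  have := X.countable
  exact occupiedProb_induce_ballSet X.graph r X.root

theorem continuous_decreasingProb (r : ℕ) :
    Continuous fun X : RootedGraph => decreasingProb X.graph r X.root := by
  simpa only [decreasingProb_ball] using continuous_comp_ball (decreasingProb_rootedIso r) r

theorem continuous_occupiedProb (r : ℕ) :
    Continuous fun X : RootedGraph => occupiedProb X.graph r X.root := by
  simpa only [occupiedProb_ball] using continuous_comp_ball (occupiedProb_rootedIso r) r

theorem integrable_decreasingProb (U : Measure RootedGraph) [IsProbabilityMeasure U] (r : ℕ) :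
    Integrable (fun X : RootedGraph => decreasingProb X.graph r X.root) U :=
  Integrable.of_bound (continuous_decreasingProb r).measurable.aestronglyMeasurable 1
    (Eventually.of_forall fun X => by
      rw [Real.norm_eq_abs, abs_of_nonneg (decreasingProb_nonneg _ _ _)]
      exact decreasingProb_le_one _ _ _)

theorem integrable_occupiedProb (U : Measure RootedGraph) [IsProbabilityMeasure U] (r : ℕ) :
    Integrable (fun X : RootedGraph => occupiedProb X.graph r X.root) U :=
  Integrable.of_bound (continuous_occupiedProb r).measurable.aestronglyMeasurable 1
    (Eventually.of_forall fun X => by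
      rw [Real.norm_eq_abs, abs_of_nonneg (occupiedProb_nonneg _ _ _)]
      exact occupiedProb_le_one _ _ _)

theorem ConvergesLocally.tendsto_decreasingProb {G : ℕ → PMF FinGraph} {U : Measure RootedGraph}
    (hloc : ConvergesLocally G U) (r : ℕ) {ε : ℝ} (hε : 0 < ε) :
    Tendsto (fun n => (G n).toOuterMeasure
      {H | ε < |(∑ v, decreasingProb H.2 r v) / (H.order : ℝ) -
        ∫ X, decreasingProb X.graph r X.root ∂U|}) atTop (𝓝 0) := by
  have h := hloc.tendsto_ballMean (decreasingProb_rootedIso r)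
    (fun X => decreasingProb_nonneg _ _ _) (fun X => decreasingProb_le_one _ _ _) r hε
  have hH : ∀ H : FinGraph, H.ballMean r (fun X => decreasingProb X.graph r X.root) =
      (∑ v, decreasingProb H.2 r v) / (H.order : ℝ) := fun H => by
    unfold FinGraph.ballMean
    congr 1
    exact Finset.sum_congr rfl fun v _ => decreasingProb_induce_ballSet H.2 r v
  simpa only [hH, decreasingProb_ball] using h

theorem ConvergesLocally.tendsto_occupiedProb {G : ℕ → PMF FinGraph} {U : Measure RootedGraph}
    (hloc : ConvergesLocally G U) (r : ℕ) {ε : ℝ} (hε : 0 < ε) :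
    Tendsto (fun n => (G n).toOuterMeasure
      {H | ε < |(∑ v, occupiedProb H.2 r v) / (H.order : ℝ) -
        ∫ X, occupiedProb X.graph r X.root ∂U|}) atTop (𝓝 0) := by
  have h := hloc.tendsto_ballMean (occupiedProb_rootedIso r)
    (fun X => occupiedProb_nonneg _ _ _) (fun X => occupiedProb_le_one _ _ _) r hε
  have hH : ∀ H : FinGraph, H.ballMean r (fun X => occupiedProb X.graph r X.root) =
      (∑ v, occupiedProb H.2 r v) / (H.order : ℝ) := fun H => by
    unfold FinGraph.ballMean
    congr 1
    exact Finset.sum_congr rfl fun v _ => occupiedProb_induce_ballSet H.2 r v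
  simpa only [hH, occupiedProb_ball] using h

/-! ### Sizes of balls -/

/-- The indicator of the event that the ball of radius `r` around `v` has more than `K`
vertices. -/
def largeBall {V : Type*} (G : SimpleGraph V) (r K : ℕ) (v : V) : ℝ :=
  if K < (ballSet G v r).ncard then 1 else 0

/-- Balls in a locally finite graph are finite, so dominated convergence applies. This tightness
takes the place of a degree bound. -/
theorem tendsto_integral_largeBall (U : Measure RootedGraph) [IsProbabilityMeasure U] (r : ℕ) :
    Tendsto (fun K : ℕ => ∫ X, largeBall X.graph r K X.root ∂U) atTop (𝓝 0) := by
  have hcont : ∀ K, Continuous fun X : RootedGraph => largeBall X.graph r K X.root := fun K =>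
    continuous_comp_ball (F := fun X => if K < Nat.card X.V then (1 : ℝ) else 0)
      (fun X Y ⟨e, _⟩ => by rw [Nat.card_congr e.toEquiv]) r
  rw [← integral_zero RootedGraph ℝ (μ := U)]
  refine tendsto_integral_of_dominated_convergence (fun _ => 1)
    (fun K => (hcont K).measurable.aestronglyMeasurable) (integrable_const _) (fun K => ?_) ?_
  · refine Eventually.of_forall fun X => ?_
    unfold largeBall
    split_ifs <;> simp
  · refine Eventually.of_forall fun X => tendsto_const_nhds.congr' ?_
    filter_upwards [eventually_ge_atTop (ballSet X.graph X.root r).ncard] with K hK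
    exact (if_neg (not_lt.2 hK)).symm

theorem ConvergesLocally.tendsto_largeBall {G : ℕ → PMF FinGraph} {U : Measure RootedGraph}
    (hloc : ConvergesLocally G U) (r K : ℕ) {ε : ℝ} (hε : 0 < ε) :
    Tendsto (fun n => (G n).toOuterMeasure
      {H | ε < |(∑ v, largeBall H.2 r K v) / (H.order : ℝ) -
        ∫ X, largeBall X.graph r K X.root ∂U|}) atTop (𝓝 0) := by
  refine hloc.tendsto_ballMean (F := fun X => if K < Nat.card X.V then (1 : ℝ) else 0)
    (fun X Y ⟨e, _⟩ => by rw [Nat.card_congr e.toEquiv])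
    (fun X => by split_ifs <;> simp) (fun X => by split_ifs <;> simp) r hε

/-! ### Nonexplosive growth -/

theorem truncPathMean_ge (P : PMF FinGraph) (r : ℕ) :
    ∑' H, P H * ENNReal.ofReal ((∑ v, decreasingProb H.2 r v) / (H.order : ℝ)) ≤
      truncPathMean P r r.factorial / (r.factorial : ℝ≥0∞) := by
  rw [truncPathMean, div_eq_mul_inv, ← ENNReal.tsum_mul_right]
  refine ENNReal.tsum_le_tsum fun H => ?_
  rw [mul_assoc]
  gcongr
  have hord : (0 : ℝ) < H.order := by unfold FinGraph.order; positivity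
  rw [ENNReal.ofReal_div_of_pos hord, ENNReal.ofReal_sum_of_nonneg
    fun v _ => decreasingProb_nonneg _ _ _, ENNReal.ofReal_natCast,
    ENNReal.mul_div_right_comm.symm, Finset.sum_mul]
  refine ENNReal.div_le_div_right (Finset.sum_le_sum fun v _ => ?_) _
  rw [decreasingProb, ofReal_measureReal]
  exact labelLaw_hasDecreasingPath_le H.2 r v

theorem exists_integral_decreasingProb_le {G : ℕ → PMF FinGraph} {U : Measure RootedGraph}
    [IsProbabilityMeasure U] (hsfpg : SubfactorialPathGrowth G) (hloc : ConvergesLocally G U)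
    {η : ℝ} (hη : 0 < η) : ∃ r, ∫ X, decreasingProb X.graph r X.root ∂U ≤ η := by
  -- One third each for the path bound, the probability of an atypical graph, and the deviation at a
  -- typical graph.
  have hη3 : 0 < η / 3 := by positivity
  have hη3' : 0 < ENNReal.ofReal (η / 3) := ENNReal.ofReal_pos.2 hη3
  obtain ⟨r, hr⟩ := (hsfpg.eventually (gt_mem_nhds hη3')).exists
  refine ⟨r, ?_⟩
  have hf0 : (r.factorial : ℝ≥0∞) ≠ 0 := by exact_mod_cast r.factorial_ne_zero
  have hft : (r.factorial : ℝ≥0∞) ≠ ⊤ := ENNReal.natCast_ne_top _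
  have hlim : limsup (fun n => truncPathMean (G n) r r.factorial) atTop <
      ENNReal.ofReal (η / 3) * r.factorial := by
    refine lt_of_le_of_lt ?_ ((ENNReal.div_lt_iff (Or.inl hf0) (Or.inl hft)).1 hr)
    exact le_iSup (fun M : ℕ => limsup (fun n => truncPathMean (G n) r M) atTop) r.factorial
  have hev := eventually_lt_of_limsup_lt hlim
  obtain ⟨n, hn, hn'⟩ := (hev.and ((hloc.tendsto_decreasingProb r hη3).eventually
    (gt_mem_nhds hη3'))).exists
  set I := ∫ X, decreasingProb X.graph r X.root ∂U with hI
  set m : FinGraph → ℝ := fun H => (∑ v, decreasingProb H.2 r v) / (H.order : ℝ) with hm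
  have hm0 : ∀ H, 0 ≤ m H := fun H =>
    div_nonneg (Finset.sum_nonneg fun v _ => decreasingProb_nonneg _ _ _) (Nat.cast_nonneg _)
  have hI1 : I ≤ 1 := by
    refine (integral_mono (integrable_decreasingProb U r) (integrable_const 1)
      fun X => decreasingProb_le_one _ _ _).trans ?_
    simp
  -- On atypical graphs `I ≤ 1` is used; averaging over `H` then bounds the constant `I`.
  have hpt : ∀ H, ENNReal.ofReal I ≤ {H | η / 3 < |m H - I|}.indicator 1 H +
      ENNReal.ofReal (m H) + ENNReal.ofReal (η / 3) := by
    intro H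
    by_cases hH : H ∈ {H | η / 3 < |m H - I|}
    · rw [Set.indicator_of_mem hH, add_assoc]
      exact (ENNReal.ofReal_le_one.2 hI1).trans le_self_add
    · rw [Set.indicator_of_notMem hH, zero_add, ← ENNReal.ofReal_add (hm0 H) hη3.le]
      refine ENNReal.ofReal_le_ofReal ?_
      have hle : |m H - I| ≤ η / 3 := not_lt.1 hH
      have := (abs_le.1 hle).1
      linarith
  have hfinal : ENNReal.ofReal I ≤ ENNReal.ofReal η := by
    calc ENNReal.ofReal I = ∑' H, G n H * ENNReal.ofReal I := by
          rw [ENNReal.tsum_mul_right, PMF.tsum_coe, one_mul]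
      _ ≤ ∑' H, (G n H * {H | η / 3 < |m H - I|}.indicator 1 H + G n H * ENNReal.ofReal (m H) +
            G n H * ENNReal.ofReal (η / 3)) := by
          refine ENNReal.tsum_le_tsum fun H => ?_
          rw [← mul_add, ← mul_add]
          exact mul_le_mul_right (hpt H) _
      _ = (G n).toOuterMeasure {H | η / 3 < |m H - I|} + ∑' H, G n H * ENNReal.ofReal (m H) +
            ENNReal.ofReal (η / 3) := by
          rw [ENNReal.tsum_add, ENNReal.tsum_add, ENNReal.tsum_mul_right, PMF.tsum_coe, one_mul,
            PMF.toOuterMeasure_apply]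
          congr 2
          refine tsum_congr fun H => ?_
          by_cases hH : H ∈ {H | η / 3 < |m H - I|}
          · simp [Set.indicator_of_mem hH]
          · simp [Set.indicator_of_notMem hH]
      _ ≤ ENNReal.ofReal (η / 3) + ENNReal.ofReal (η / 3) + ENNReal.ofReal (η / 3) := by
          gcongr
          exact (truncPathMean_ge (G n) r).trans
            ((ENNReal.div_lt_iff (Or.inl hf0) (Or.inl hft)).2 hn).le
      _ = ENNReal.ofReal η := by
          rw [← ENNReal.ofReal_add hη3.le hη3.le, ← ENNReal.ofReal_add (by positivity) hη3.le]
          congr 1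
          ring
  exact (ENNReal.ofReal_le_ofReal_iff hη.le).1 hfinal

theorem antitone_decreasingProb {V : Type*} (G : SimpleGraph V) (v : V) :
    Antitone fun k => decreasingProb G k v :=
  antitone_nat_of_succ_le fun _ => measureReal_mono fun _ hσ => hσ.of_succ

/-- The probabilities decrease in `r`, so they converge to their infimum, a nonnegative function
whose integral vanishes. -/
theorem ae_tendsto_decreasingProb {U : Measure RootedGraph} [IsProbabilityMeasure U]
    (hU : ∀ η : ℝ, 0 < η → ∃ r, ∫ X, decreasingProb X.graph r X.root ∂U ≤ η) :
    ∀ᵐ X ∂U, Tendsto (fun r => decreasingProb X.graph r X.root) atTop (𝓝 0) := by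
  have hbdd : ∀ X : RootedGraph, BddBelow (Set.range fun r => decreasingProb X.graph r X.root) :=
    fun X => ⟨0, by rintro _ ⟨r, rfl⟩; exact decreasingProb_nonneg _ _ _⟩
  have hm0 : ∀ X : RootedGraph, 0 ≤ ⨅ r, decreasingProb X.graph r X.root := fun X =>
    Real.iInf_nonneg fun r => decreasingProb_nonneg _ _ _
  have hmeas : Measurable fun X : RootedGraph => ⨅ r, decreasingProb X.graph r X.root :=
    Measurable.iInf fun r => (continuous_decreasingProb r).measurable
  have hint : Integrable (fun X : RootedGraph => ⨅ r, decreasingProb X.graph r X.root) U :=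
    (integrable_decreasingProb U 0).mono' hmeas.aestronglyMeasurable
      (Eventually.of_forall fun X => by
        rw [Real.norm_eq_abs, abs_of_nonneg (hm0 X)]
        exact ciInf_le (hbdd X) 0)
  have hzero : ∫ X : RootedGraph, ⨅ r, decreasingProb X.graph r X.root ∂U = 0 := by
    refine le_antisymm (le_of_forall_pos_le_add fun η hη => ?_) (integral_nonneg hm0)
    obtain ⟨r, hr⟩ := hU η hη
    rw [zero_add]
    exact (integral_mono hint (integrable_decreasingProb U r)
      fun X => ciInf_le (hbdd X) r).trans hr
  filter_upwards [(integral_eq_zero_iff_of_nonneg hm0 hint).1 hzero] with X hX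
  have := tendsto_atTop_ciInf (antitone_decreasingProb X.graph X.root) (hbdd X)
  rwa [show (⨅ r, decreasingProb X.graph r X.root) = 0 from hX] at this

theorem nonexplosiveGrowth_of_tendsto {U : Measure RootedGraph}
    (hU : ∀ᵐ X ∂U, Tendsto (fun r => decreasingProb X.graph r X.root) atTop (𝓝 0)) :
    NonexplosiveGrowth U := by
  filter_upwards [hU] with X hX
  rw [ae_iff]
  have hreal : (labelLaw X.V).real {σ | ¬ (past X.graph σ X.root).Finite} ≤ 0 := by
    refine ge_of_tendsto' hX fun r => measureReal_mono fun σ hσ => ?_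
    by_contra h
    exact hσ ((ballSet_finite X.locallyFinite X.root r).subset (past_subset_ballSet h))
  exact (measureReal_eq_zero_iff).1 (le_antisymm hreal measureReal_nonneg)

/-! ### The root density -/

theorem abs_rootOccupied_sub_le (X : RootedGraph) (r : ℕ) :
    |(labelLaw X.V).real {σ | RootOccupied X σ} - occupiedProb X.graph r X.root| ≤
      decreasingProb X.graph r X.root := by
  have := X.countable
  have hinj : labelLaw X.V {σ | ¬ Function.Injective σ} = 0 := ae_iff.1 (ae_injective_label X.V)
  have hinj' : (labelLaw X.V).real {σ | ¬ Function.Injective σ} = 0 := by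
    rw [measureReal_def, hinj]; rfl
  -- Only monotonicity and subadditivity are used, so neither event has to be measurable.
  have key : ∀ A B : Set (X.V → unitInterval), (∀ σ ∈ A, Function.Injective σ →
      ¬ HasDecreasingPath X.graph σ r X.root → σ ∈ B) → (labelLaw X.V).real A ≤
      (labelLaw X.V).real B + decreasingProb X.graph r X.root := by
    intro A B h
    calc (labelLaw X.V).real A ≤ (labelLaw X.V).real
          ((B ∪ {σ | HasDecreasingPath X.graph σ r X.root}) ∪ {σ | ¬ Function.Injective σ}) := by
          refine measureReal_mono fun σ hσ => ?_
          by_cases h1 : Function.Injective σ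
          · by_cases h2 : HasDecreasingPath X.graph σ r X.root
            · exact Or.inl (Or.inr h2)
            · exact Or.inl (Or.inl (h σ hσ h1 h2))
          · exact Or.inr h1
      _ ≤ (labelLaw X.V).real (B ∪ {σ | HasDecreasingPath X.graph σ r X.root}) + 0 := by
          rw [← hinj']; exact measureReal_union_le _ _
      _ ≤ _ := by rw [add_zero]; exact measureReal_union_le _ _
  rw [abs_le]
  constructor
  · have := key {σ | Occupied X.graph σ r X.root} {σ | RootOccupied X σ}
      fun σ hσ h1 h2 => (rootOccupied_iff h1 h2).2 hσ
    change occupiedProb X.graph r X.root ≤ _ at this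
    linarith
  · have := key {σ | RootOccupied X σ} {σ | Occupied X.graph σ r X.root}
      fun σ hσ h1 h2 => (rootOccupied_iff h1 h2).1 hσ
    change _ ≤ occupiedProb X.graph r X.root + _ at this
    linarith

/-- With positive probability the root's label is below `1/2` and those of its finitely many
neighbours are above. -/
theorem rootOccupied_prob_pos (X : RootedGraph) :
    0 < (labelLaw X.V).real {σ | RootOccupied X σ} := by
  classical
  have := X.countable
  have hpos : 0 < labelLaw X.V {σ | RootOccupied X σ} := by
    let c : unitInterval := ⟨1 / 2, by norm_num, by norm_num⟩
    let s : Finset X.V := insert X.root (X.locallyFinite X.root).toFinset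
    let t : X.V → Set unitInterval := fun v => if v = X.root then Set.Iio c else Set.Ioi c
    have ht : ∀ v, MeasurableSet (t v) := fun v => by
      dsimp only [t]; split_ifs
      · exact measurableSet_Iio
      · exact measurableSet_Ioi
    have hbox : 0 < labelLaw X.V ((s : Set X.V).pi t) := by
      rw [labelLaw, Measure.infinitePi_pi _ fun v _ => ht v]
      refine pos_iff_ne_zero.2 (Finset.prod_ne_zero_iff.2 fun v _ => ?_)
      dsimp only [t]
      split_ifs
      · rw [unitInterval.volume_Iio]; simp [c]
      · rw [unitInterval.volume_Ioi]; simp [c]; norm_num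
    refine hbox.trans_le (measure_mono_ae ?_)
    filter_upwards [ae_injective_label X.V] with σ hσ hmem
    refine rootOccupied_of_lt hσ fun w hw => ?_
    have h1 : σ X.root ∈ t X.root := hmem X.root (by simp [s])
    have h2 : σ w ∈ t w := hmem w (by simp [s, hw])
    simp only [t, if_true] at h1
    simp only [t, if_neg hw.ne'] at h2
    exact lt_trans h1 h2
  exact ENNReal.toReal_pos hpos.ne' (measure_ne_top _ _)

/-- Measurability in `X` comes from the almost everywhere limit of the continuous truncated
probabilities. -/
theorem integrable_rootOccupied {U : Measure RootedGraph} [IsProbabilityMeasure U]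
    (hU : ∀ᵐ X ∂U, Tendsto (fun r => decreasingProb X.graph r X.root) atTop (𝓝 0)) :
    Integrable (fun X : RootedGraph => (labelLaw X.V).real {σ | RootOccupied X σ}) U := by
  have hmeas : AEMeasurable
      (fun X : RootedGraph => (labelLaw X.V).real {σ | RootOccupied X σ}) U := by
    refine aemeasurable_of_tendsto_metrizable_ae'
      (fun r => (continuous_occupiedProb r).measurable.aemeasurable) ?_
    filter_upwards [hU] with X hX
    refine tendsto_iff_dist_tendsto_zero.2 (squeeze_zero (fun _ => dist_nonneg) (fun r => ?_) hX)
    rw [dist_comm]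
    exact abs_rootOccupied_sub_le X r
  refine Integrable.of_bound hmeas.aestronglyMeasurable 1 (Eventually.of_forall fun X => ?_)
  rw [Real.norm_eq_abs, abs_of_nonneg measureReal_nonneg]
  exact measureReal_le_one

theorem rootDensity_eq_integral {U : Measure RootedGraph} [IsProbabilityMeasure U]
    (hU : ∀ᵐ X ∂U, Tendsto (fun r => decreasingProb X.graph r X.root) atTop (𝓝 0)) :
    rootDensity U = ∫ X : RootedGraph, (labelLaw X.V).real {σ | RootOccupied X σ} ∂U := by
  refine (integral_toReal ?_ (Eventually.of_forall fun X => measure_lt_top _ _)).symm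
  refine (integrable_rootOccupied hU).aemeasurable.ennreal_ofReal.congr
    (Eventually.of_forall fun X => ?_)
  exact ofReal_measureReal

theorem rootDensity_pos {U : Measure RootedGraph} [IsProbabilityMeasure U]
    (hU : ∀ᵐ X ∂U, Tendsto (fun r => decreasingProb X.graph r X.root) atTop (𝓝 0)) :
    0 < rootDensity U := by
  rw [rootDensity_eq_integral hU, integral_pos_iff_support_of_nonneg
    (fun X => measureReal_nonneg) (integrable_rootOccupied hU)]
  have : Function.support
      (fun X : RootedGraph => (labelLaw X.V).real {σ | RootOccupied X σ}) = Set.univ :=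
    Set.eq_univ_of_forall fun X => (rootOccupied_prob_pos X).ne'
  rw [this]
  simp

theorem abs_rootDensity_sub_le {U : Measure RootedGraph} [IsProbabilityMeasure U]
    (hU : ∀ᵐ X ∂U, Tendsto (fun r => decreasingProb X.graph r X.root) atTop (𝓝 0)) (r : ℕ) :
    |rootDensity U - ∫ X, occupiedProb X.graph r X.root ∂U| ≤
      ∫ X, decreasingProb X.graph r X.root ∂U := by
  rw [rootDensity_eq_integral hU,
    ← integral_sub (integrable_rootOccupied hU) (integrable_occupiedProb U r)]
  refine (abs_integral_le_integral_abs).trans (integral_mono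
    ((integrable_rootOccupied hU).sub (integrable_occupiedProb U r)).abs
    (integrable_decreasingProb U r) fun X => abs_rootOccupied_sub_le X r)

/-! ### Concentration in a finite graph -/

/-- The indicator of the event that `v` is occupied, the greedy rule being cut off at depth `r`. -/
def occupiedInd {V : Type*} (G : SimpleGraph V) (r : ℕ) (v : V) (σ : V → unitInterval) : ℝ :=
  {σ | Occupied G σ r v}.indicator 1 σ

/-- The indicator of the event that a decreasing path of length `r` starts at `v`. -/
def decreasingInd {V : Type*} (G : SimpleGraph V) (r : ℕ) (v : V) (σ : V → unitInterval) : ℝ :=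
  {σ | HasDecreasingPath G σ r v}.indicator 1 σ

theorem measurable_occupiedInd {V : Type*} [Countable V] (G : SimpleGraph V) (r : ℕ) (v : V) :
    Measurable (occupiedInd G r v) :=
  measurable_one.indicator (measurableSet_occupied G r v)

theorem occupiedInd_nonneg {V : Type*} (G : SimpleGraph V) (r : ℕ) (v : V) (σ : V → unitInterval) :
    0 ≤ occupiedInd G r v σ :=
  Set.indicator_nonneg (fun _ _ => zero_le_one) σ

theorem occupiedInd_le_one {V : Type*} (G : SimpleGraph V) (r : ℕ) (v : V) (σ : V → unitInterval) :
    occupiedInd G r v σ ≤ 1 :=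
  Set.indicator_le_self' (fun _ _ => zero_le_one) σ

theorem decreasingInd_nonneg {V : Type*} (G : SimpleGraph V) (r : ℕ) (v : V)
    (σ : V → unitInterval) : 0 ≤ decreasingInd G r v σ :=
  Set.indicator_nonneg (fun _ _ => zero_le_one) σ

theorem integral_occupiedInd {V : Type*} [Countable V] (G : SimpleGraph V) (r : ℕ) (v : V) :
    ∫ σ, occupiedInd G r v σ ∂(labelLaw V) = occupiedProb G r v :=
  integral_indicator_one (measurableSet_occupied G r v)

theorem integral_decreasingInd {V : Type*} [Countable V] (G : SimpleGraph V) (r : ℕ) (v : V) :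
    ∫ σ, decreasingInd G r v σ ∂(labelLaw V) = decreasingProb G r v :=
  integral_indicator_one (measurableSet_hasDecreasingPath G r v)

theorem memLp_occupiedInd {V : Type*} [Countable V] (G : SimpleGraph V) (r : ℕ) (v : V) :
    MemLp (occupiedInd G r v) 2 (labelLaw V) :=
  MemLp.of_bound (measurable_occupiedInd G r v).aestronglyMeasurable 1
    (Eventually.of_forall fun σ => by
      rw [Real.norm_eq_abs, abs_of_nonneg (occupiedInd_nonneg _ _ _ _)]
      exact occupiedInd_le_one _ _ _ _)

theorem integrable_decreasingInd {V : Type*} [Countable V] (G : SimpleGraph V) (r : ℕ) (v : V) :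
    Integrable (decreasingInd G r v) (labelLaw V) :=
  (integrable_const (1 : ℝ)).indicator (measurableSet_hasDecreasingPath G r v)

/-- Vertices with disjoint balls are occupied independently of each other. -/
theorem indepFun_occupiedInd {V : Type*} [Finite V] (G : SimpleGraph V) (r : ℕ) {v w : V}
    (h : Disjoint (ballSet G v r) (ballSet G w r)) :
    ProbabilityTheory.IndepFun (occupiedInd G r v) (occupiedInd G r w) (labelLaw V) := by
  classical
  have hfin : ∀ u, (ballSet G u r).Finite := fun u => Set.toFinite _
  have hmem : ∀ u, u ∈ ((hfin u).toFinset : Set V) := fun u => by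
    simpa using self_mem_ballSet G u r
  have hsub : ∀ u, ballSet G u r ⊆ ((hfin u).toFinset : Set V) := fun u => by simp
  have hcomp : ∀ u, occupiedInd G r u =
      occupiedInd (G.induce ((hfin u).toFinset : Set V)) r ⟨u, hmem u⟩ ∘
        fun σ (i : ((hfin u).toFinset : Set V)) => σ i := fun u => by
    funext σ
    have h1 := occupied_induce (σ := σ) (hsub u) (hmem u)
    simp only [occupiedInd, Function.comp_apply, Set.indicator_apply, Set.mem_ofPred_eq]
    exact if_congr h1.symm rfl rfl
  have hind := (ProbabilityTheory.iIndepFun_infinitePi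
    (P := fun _ : V => (volume : Measure unitInterval))
    (X := fun _ x => x) fun _ => measurable_id).indepFun_finset (hfin v).toFinset
      (hfin w).toFinset (by simpa using h) fun i => measurable_pi_apply i
  rw [hcomp v, hcomp w]
  exact hind.comp (measurable_occupiedInd _ _ _) (measurable_occupiedInd _ _ _)

theorem mem_ballSet_of_not_disjoint {V : Type*} {G : SimpleGraph V} {r : ℕ} {v w : V}
    (h : ¬ Disjoint (ballSet G v r) (ballSet G w r)) : w ∈ ballSet G v (2 * r) := by
  obtain ⟨x, hx, hx'⟩ := Set.not_disjoint_iff.1 h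
  obtain ⟨p, hp⟩ := mem_ballSet_iff.1 hx
  obtain ⟨q, hq⟩ := mem_ballSet_iff.1 hx'
  refine mem_ballSet_iff.2 ⟨p.append q.reverse, ?_⟩
  rw [SimpleGraph.Walk.length_append, SimpleGraph.Walk.length_reverse]
  omega

/-- Covariances vanish unless the `r`-balls meet, which forces distance at most `2r`, and never
exceed `1`. A row of the covariance sum thus contributes at most the size of a `2r`-ball: at most
`K`, or at most `|V|` if that ball is large. -/
theorem variance_sum_occupiedInd_le {V : Type*} [Fintype V] (G : SimpleGraph V) (r K : ℕ) :
    ProbabilityTheory.variance (fun σ => ∑ v, occupiedInd G r v σ) (labelLaw V) ≤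
      (Fintype.card V : ℝ) * (K + ∑ v, largeBall G (2 * r) K v) := by
  classical
  rw [ProbabilityTheory.variance_fun_sum' fun v _ => memLp_occupiedInd G r v]
  calc ∑ v, ∑ w, ProbabilityTheory.covariance (occupiedInd G r v) (occupiedInd G r w) (labelLaw V)
      ≤ ∑ v, ∑ w, if w ∈ ballSet G v (2 * r) then (1 : ℝ) else 0 := by
        refine Finset.sum_le_sum fun v _ => Finset.sum_le_sum fun w _ => ?_
        by_cases hd : Disjoint (ballSet G v r) (ballSet G w r)
        · rw [(indepFun_occupiedInd G r hd).covariance_eq_zero (memLp_occupiedInd G r v)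
            (memLp_occupiedInd G r w)]
          split_ifs <;> simp
        · rw [if_pos (mem_ballSet_of_not_disjoint hd), ProbabilityTheory.covariance_eq_sub
            (memLp_occupiedInd G r v) (memLp_occupiedInd G r w), integral_occupiedInd,
            integral_occupiedInd]
          have h1 : ∫ σ, (occupiedInd G r v * occupiedInd G r w) σ ∂(labelLaw V) ≤ 1 := by
            refine (integral_mono
              ((memLp_occupiedInd G r v).integrable_mul (memLp_occupiedInd G r w))
              (integrable_const 1) fun σ => ?_).trans (by simp)
            exact mul_le_one₀ (occupiedInd_le_one _ _ _ _) (occupiedInd_nonneg _ _ _ _)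
              (occupiedInd_le_one _ _ _ _)
          have h2 := mul_nonneg (occupiedProb_nonneg G r v) (occupiedProb_nonneg G r w)
          linarith
    _ ≤ ∑ v, (K + (Fintype.card V : ℝ) * largeBall G (2 * r) K v) := by
        refine Finset.sum_le_sum fun v _ => ?_
        have hcard : (∑ w, if w ∈ ballSet G v (2 * r) then (1 : ℝ) else 0) =
            (ballSet G v (2 * r)).ncard := by
          rw [Finset.sum_boole, Set.ncard_eq_toFinset_card', Set.filter_mem_univ_eq_toFinset]
        rw [hcard, largeBall]
        split_ifs with h
        · have : (ballSet G v (2 * r)).ncard ≤ Fintype.card V := by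
            rw [← Nat.card_eq_fintype_card]; exact Set.ncard_le_card _
          have : ((ballSet G v (2 * r)).ncard : ℝ) ≤ Fintype.card V := by exact_mod_cast this
          have : (0 : ℝ) ≤ K := Nat.cast_nonneg _
          linarith
        · have : ((ballSet G v (2 * r)).ncard : ℝ) ≤ K := by exact_mod_cast not_lt.1 h
          linarith
    _ = _ := by
        rw [Finset.sum_add_distrib, Finset.sum_const, Finset.card_univ, nsmul_eq_mul,
          ← Finset.mul_sum, mul_add]

theorem labelLaw_occupied_deviation_le {V : Type*} [Fintype V] [Nonempty V] (G : SimpleGraph V)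
    (r K : ℕ) {δ : ℝ} (hδ : 0 < δ) :
    labelLaw V {σ | δ * Fintype.card V ≤ |∑ v, occupiedInd G r v σ - ∑ v, occupiedProb G r v|} ≤
      ENNReal.ofReal ((K / Fintype.card V +
        (∑ v, largeBall G (2 * r) K v) / Fintype.card V) / δ ^ 2) := by
  have hn : (0 : ℝ) < Fintype.card V := by exact_mod_cast Fintype.card_pos
  have hmem : MemLp (fun σ => ∑ v, occupiedInd G r v σ) 2 (labelLaw V) :=
    memLp_finsetSum _ fun v _ => memLp_occupiedInd G r v
  have hint : ∫ σ, ∑ v, occupiedInd G r v σ ∂(labelLaw V) = ∑ v, occupiedProb G r v := by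
    rw [integral_finsetSum _ fun v _ => (memLp_occupiedInd G r v).integrable (by norm_num)]
    simp only [integral_occupiedInd]
  have h := ProbabilityTheory.meas_ge_le_variance_div_sq hmem (mul_pos hδ hn)
  rw [hint] at h
  refine h.trans (ENNReal.ofReal_le_ofReal ?_)
  calc _ ≤ (Fintype.card V : ℝ) * (K + ∑ v, largeBall G (2 * r) K v) /
        (δ * Fintype.card V) ^ 2 := by
        gcongr
        exact variance_sum_occupiedInd_le G r K
    _ = _ := by
        field_simp

theorem labelLaw_decreasing_deviation_le {V : Type*} [Fintype V] [Nonempty V] (G : SimpleGraph V)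
    (r : ℕ) {δ : ℝ} (hδ : 0 < δ) :
    labelLaw V {σ | δ * Fintype.card V ≤ ∑ v, decreasingInd G r v σ} ≤
      ENNReal.ofReal ((∑ v, decreasingProb G r v) / Fintype.card V / δ) := by
  have hn : (0 : ℝ) < Fintype.card V := by exact_mod_cast Fintype.card_pos
  have h := mul_meas_ge_le_integral_of_nonneg (μ := labelLaw V)
    (f := fun σ => ∑ v, decreasingInd G r v σ)
    (Eventually.of_forall fun σ => Finset.sum_nonneg fun v _ => decreasingInd_nonneg _ _ _ _)
    (integrable_finsetSum _ fun v _ => integrable_decreasingInd G r v) (δ * Fintype.card V)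
  rw [integral_finsetSum _ fun v _ => integrable_decreasingInd G r v] at h
  simp only [integral_decreasingInd] at h
  rw [← ofReal_measureReal]
  refine ENNReal.ofReal_le_ofReal ?_
  rw [div_div, le_div_iff₀ (by positivity)]
  linarith

/-- The greedy independent set differs from the set of occupied vertices only where a long
decreasing path starts. -/
theorem abs_card_greedySet_sub_le {n : ℕ} (G : SimpleGraph (Fin n)) (r : ℕ)
    {π : Equiv.Perm (Fin n)} {σ : Fin n → unitInterval} (hσ : StrictMono (σ ∘ π)) :
    |((greedySet G (List.ofFn π)).card : ℝ) - ∑ v, occupiedInd G r v σ| ≤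
      ∑ v, decreasingInd G r v σ := by
  classical
  have hall : ∀ v, v ∈ List.ofFn π := fun v => List.mem_ofFn.2 ⟨π.symm v, π.apply_symm_apply v⟩
  have hl : (List.ofFn π).Pairwise fun a b => σ a < σ b :=
    List.pairwise_ofFn.2 fun i j hij => hσ hij
  have hcard : ((greedySet G (List.ofFn π)).card : ℝ) =
      ∑ v, if v ∈ greedySet G (List.ofFn π) then (1 : ℝ) else 0 := by
    simp
  rw [hcard, ← Finset.sum_sub_distrib]
  refine (Finset.abs_sum_le_sum_abs _ _).trans (Finset.sum_le_sum fun v _ => ?_)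
  simp only [occupiedInd, decreasingInd, Set.indicator_apply, Set.mem_ofPred_eq, Pi.one_apply]
  by_cases h : HasDecreasingPath G σ r v
  · rw [if_pos h]
    split_ifs <;> simp
  · rw [if_neg h, if_congr (mem_greedySet_iff_occupied hall hl h) rfl rfl]
    simp

/-- The three `δ` pay for the truncation (Markov), the fluctuation of the truncated count
(Chebyshev), and the distance of its mean from `c`. -/
theorem uniform_greedyRatio_deviation_le (H : FinGraph) (r K : ℕ) {c δ : ℝ} (hδ : 0 < δ)
    (hc : |(∑ v, occupiedProb H.2 r v) / (H.order : ℝ) - c| ≤ δ) :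
    (PMF.uniformOfFintype (Equiv.Perm (Fin (H.1 + 1)))).toOuterMeasure
      {π | 3 * δ < |greedyRatio H π - c|} ≤
      ENNReal.ofReal ((K / (H.order : ℝ) +
        (∑ v, largeBall H.2 (2 * r) K v) / (H.order : ℝ)) / δ ^ 2) +
      ENNReal.ofReal ((∑ v, decreasingProb H.2 r v) / (H.order : ℝ) / δ) := by
  have hord : (H.order : ℝ) = Fintype.card (Fin (H.1 + 1)) := by
    rw [Fintype.card_fin]; rfl
  have hn : (0 : ℝ) < H.order := by unfold FinGraph.order; positivity
  refine (uniform_perm_le _ (A := {σ | δ * H.order ≤ |∑ v, occupiedInd H.2 r v σ -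
    ∑ v, occupiedProb H.2 r v|} ∪ {σ | δ * H.order ≤ ∑ v, decreasingInd H.2 r v σ}) ?_).trans
    ((measure_union_le _ _).trans ?_)
  · intro π hπ σ hσ
    by_contra hA
    rw [Set.mem_union, not_or] at hA
    have h1 : |∑ v, occupiedInd H.2 r v σ - ∑ v, occupiedProb H.2 r v| < δ * H.order :=
      not_le.1 hA.1
    have h2 : ∑ v, decreasingInd H.2 r v σ < δ * H.order := not_le.1 hA.2
    have h3 := abs_card_greedySet_sub_le H.2 r hσ
    have h4 : |greedyRatio H π - (∑ v, occupiedProb H.2 r v) / (H.order : ℝ)| ≤ 2 * δ := by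
      rw [greedyRatio, ← sub_div, abs_div, abs_of_pos hn, div_le_iff₀ hn]
      refine (abs_sub_le _ (∑ v, occupiedInd H.2 r v σ) _).trans ?_
      linarith
    have h5 := abs_sub_le (greedyRatio H π) ((∑ v, occupiedProb H.2 r v) / (H.order : ℝ)) c
    have h6 : 3 * δ < |greedyRatio H π - c| := hπ
    linarith
  · rw [hord]
    exact add_le_add (labelLaw_occupied_deviation_le H.2 r K hδ)
      (labelLaw_decreasing_deviation_le H.2 r hδ)

/-! ### The greedy independence ratio of a random graph -/

theorem toOuterMeasure_add_compl {α : Type*} (P : PMF α) (s : Set α) :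
    P.toOuterMeasure s + P.toOuterMeasure sᶜ = 1 := by
  rw [PMF.toOuterMeasure_apply, PMF.toOuterMeasure_apply, ← ENNReal.tsum_add, ← P.tsum_coe]
  exact tsum_congr fun a => congrFun (Set.indicator_self_add_compl s P) a

/-- An average is small if the averaged function is small outside of an event of small
probability. -/
theorem tsum_mul_le_add_toOuterMeasure {α : Type*} (P : PMF α) {q : α → ℝ≥0∞} {η : ℝ≥0∞}
    {s : Set α} (h1 : ∀ a, q a ≤ 1) (hq : ∀ a ∉ s, q a ≤ η) :
    ∑' a, P a * q a ≤ η + P.toOuterMeasure s := by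
  calc ∑' a, P a * q a ≤ ∑' a, (P a * η + s.indicator P a) := by
        refine ENNReal.tsum_le_tsum fun a => ?_
        by_cases ha : a ∈ s
        · rw [Set.indicator_of_mem ha]
          exact (mul_le_of_le_one_right' (h1 a)).trans le_add_self
        · exact (mul_le_mul_right (hq a ha) _).trans le_self_add
    _ = _ := by
        rw [ENNReal.tsum_add, ENNReal.tsum_mul_right, P.tsum_coe, one_mul, PMF.toOuterMeasure_apply]

theorem tendsto_greedyRatioLaw {G : ℕ → PMF FinGraph} {U : Measure RootedGraph}
    [IsProbabilityMeasure U] (hord : OrderTendsto G) (hloc : ConvergesLocally G U)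
    (hU : ∀ η : ℝ, 0 < η → ∃ r, ∫ X, decreasingProb X.graph r X.root ∂U ≤ η)
    {e : ℝ} (he : 0 < e) :
    Tendsto (fun n => (greedyRatioLaw (G n)).toOuterMeasure {x | e < |x - rootDensity U|})
      atTop (𝓝 0) := by
  refine ENNReal.tendsto_nhds_zero.2 fun η' hη' => ?_
  -- Five shares: one for the random order on a good graph, four for the bad events `B1` to `B4`.
  obtain ⟨η, hη0, hηlt⟩ := ENNReal.lt_iff_exists_nnreal_btwn.1
    (ENNReal.div_pos hη'.ne' (by norm_num : (5 : ℝ≥0∞) ≠ ⊤))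
  have hη : (0 : ℝ) < η := by exact_mod_cast hη0
  have h5 : 5 * (η : ℝ≥0∞) ≤ η' := by
    rw [mul_comm]; exact (ENNReal.le_div_iff_mul_le (by simp) (by simp)).1 hηlt.le
  set c := rootDensity U
  set δ := e / 3 with hδdef
  have hδ : 0 < δ := by positivity
  -- The first bound leaves `δ/2` for the truncation error in the limit. The second makes the Markov
  -- term at most `2γ/δ ≤ η/2`, the integral and its deviation each costing `γ`.
  set γ := min (δ / 2) (η * δ / 4)
  have hγ : 0 < γ := lt_min (by positivity) (by positivity)
  -- The Chebyshev term is at most `3κ/δ² = η/2`: one `κ` each for `K` over the order, the integral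
  -- of `largeBall`, and the deviation from it.
  set κ := η * δ ^ 2 / 6
  have hκ : 0 < κ := by positivity
  obtain ⟨r, hr⟩ := hU γ hγ
  obtain ⟨K, hK⟩ :=
    ((tendsto_integral_largeBall U (2 * r)).eventually (gt_mem_nhds hκ)).exists
  obtain ⟨N, hN⟩ := exists_nat_ge ((K : ℝ) / κ)
  have hcf := abs_rootDensity_sub_le (ae_tendsto_decreasingProb hU) r
  have hev : ∀ {u : ℕ → ℝ≥0∞}, Tendsto u atTop (𝓝 0) → ∀ᶠ n in atTop, u n ≤ η := fun hu =>
    ENNReal.tendsto_nhds_zero.1 hu _ hη0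
  filter_upwards [hev (hord N), hev (hloc.tendsto_occupiedProb r (half_pos hδ)),
    hev (hloc.tendsto_decreasingProb r hγ), hev (hloc.tendsto_largeBall (2 * r) K hκ)]
    with n hn1 hn2 hn3 hn4
  rw [greedyRatioLaw, PMF.toOuterMeasure_bind_apply]
  set B1 : Set FinGraph := {H | H.order ≤ N}
  set B2 : Set FinGraph := {H | δ / 2 < |(∑ v, occupiedProb H.2 r v) / (H.order : ℝ) -
        ∫ X, occupiedProb X.graph r X.root ∂U|}
  set B3 : Set FinGraph := {H | γ < |(∑ v, decreasingProb H.2 r v) / (H.order : ℝ) -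
        ∫ X, decreasingProb X.graph r X.root ∂U|}
  set B4 : Set FinGraph := {H | κ < |(∑ v, largeBall H.2 (2 * r) K v) / (H.order : ℝ) -
        ∫ X, largeBall X.graph (2 * r) K X.root ∂U|}
  refine (tsum_mul_le_add_toOuterMeasure (G n) (η := η) (s := (B1 ∪ B2) ∪ (B3 ∪ B4))
    (fun H => ?_) fun H hH => ?_).trans ?_
  · exact (le_self_add).trans (toOuterMeasure_add_compl _ _).le
  · simp only [Set.mem_union, not_or] at hH
    obtain ⟨⟨hH1, hH2⟩, hH3, hH4⟩ := hH
    replace hH1 : N < H.order := not_le.1 hH1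
    replace hH2 : |(∑ v, occupiedProb H.2 r v) / (H.order : ℝ) -
        ∫ X, occupiedProb X.graph r X.root ∂U| ≤ δ / 2 := not_lt.1 hH2
    replace hH3 : |(∑ v, decreasingProb H.2 r v) / (H.order : ℝ) -
        ∫ X, decreasingProb X.graph r X.root ∂U| ≤ γ := not_lt.1 hH3
    replace hH4 : |(∑ v, largeBall H.2 (2 * r) K v) / (H.order : ℝ) -
        ∫ X, largeBall X.graph (2 * r) K X.root ∂U| ≤ κ := not_lt.1 hH4
    have hc : |(∑ v, occupiedProb H.2 r v) / (H.order : ℝ) - c| ≤ δ := by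
      refine (abs_sub_le _ (∫ X, occupiedProb X.graph r X.root ∂U) _).trans ?_
      rw [abs_sub_comm _ c]
      have : γ ≤ δ / 2 := min_le_left _ _
      linarith
    rw [PMF.toOuterMeasure_map_apply]
    have h3 : (3 : ℝ) * δ = e := by rw [hδdef]; ring
    have hmain := uniform_greedyRatio_deviation_le H r K hδ hc
    rw [h3] at hmain
    refine hmain.trans ?_
    have hnpos : (0 : ℝ) < H.order := by unfold FinGraph.order; positivity
    have hKn : (K : ℝ) / H.order ≤ κ := by
      rw [div_le_iff₀ hnpos]
      have h1 : (N : ℝ) ≤ H.order := by exact_mod_cast hH1.le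
      rw [div_le_iff₀ hκ] at hN
      nlinarith
    have hA : ((K : ℝ) / H.order + (∑ v, largeBall H.2 (2 * r) K v) / (H.order : ℝ)) / δ ^ 2 ≤
        η / 2 := by
      rw [div_le_iff₀ (by positivity)]
      have h1 := (abs_le.1 hH4).2
      have h2 : η / 2 * δ ^ 2 = 3 * κ := by simp only [κ]; ring
      rw [h2]
      linarith
    have hD : (∑ v, decreasingProb H.2 r v) / (H.order : ℝ) / δ ≤ η / 2 := by
      rw [div_le_iff₀ hδ]
      have h1 := (abs_le.1 hH3).2
      have h2 : γ ≤ η * δ / 4 := min_le_right _ _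
      linarith
    refine (add_le_add (ENNReal.ofReal_le_ofReal hA) (ENNReal.ofReal_le_ofReal hD)).trans ?_
    rw [← ENNReal.ofReal_add (by positivity) (by positivity), add_halves,
      ENNReal.ofReal_coe_nnreal]
  · refine le_trans ?_ h5
    have hB : (G n).toOuterMeasure ((B1 ∪ B2) ∪ (B3 ∪ B4)) ≤ (η + η) + (η + η) :=
      (measure_union_le _ _).trans (add_le_add
        ((measure_union_le _ _).trans (add_le_add hn1 hn2))
        ((measure_union_le _ _).trans (add_le_add hn3 hn4)))
    refine (add_le_add le_rfl hB).trans (le_of_eq ?_)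
    ring

end GreedyMIS

end

theorem theorem1p2 (G : ℕ → PMF GreedyMIS.FinGraph)
    (U : Measure GreedyMIS.RootedGraph) [IsProbabilityMeasure U]
    (hord : GreedyMIS.OrderTendsto G)
    (hsfpg : GreedyMIS.SubfactorialPathGrowth G)
    (hloc : GreedyMIS.ConvergesLocally G U) :
    GreedyMIS.NonexplosiveGrowth U ∧
      ∀ ε : ℝ, 0 < ε →
        Tendsto (fun n => (GreedyMIS.greedyRatioLaw (G n)).toOuterMeasure
          {x : ℝ | |x - GreedyMIS.rootDensity U| ≤ ε * GreedyMIS.rootDensity U})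
          atTop (𝓝 1) := by
  have hU : ∀ η : ℝ, 0 < η →
      ∃ r, ∫ X, GreedyMIS.decreasingProb X.graph r X.root ∂U ≤ η := fun η hη =>
    GreedyMIS.exists_integral_decreasingProb_le hsfpg hloc hη
  have hae := GreedyMIS.ae_tendsto_decreasingProb hU
  refine ⟨GreedyMIS.nonexplosiveGrowth_of_tendsto hae, fun ε hε => ?_⟩
  -- Positivity of the limiting density makes `ε` times it an admissible additive error.
  have hbad := GreedyMIS.tendsto_greedyRatioLaw hord hloc hU
    (mul_pos hε (GreedyMIS.rootDensity_pos hae))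
  have hgood := ENNReal.Tendsto.sub (tendsto_const_nhds (x := (1 : ℝ≥0∞))) hbad
    (Or.inl ENNReal.one_ne_top)
  rw [tsub_zero] at hgood
  refine hgood.congr fun n => ?_
  have hsum := GreedyMIS.toOuterMeasure_add_compl (GreedyMIS.greedyRatioLaw (G n))
    {x : ℝ | |x - GreedyMIS.rootDensity U| ≤ ε * GreedyMIS.rootDensity U}
  have hcompl : {x : ℝ | |x - GreedyMIS.rootDensity U| ≤ ε * GreedyMIS.rootDensity U}ᶜ =
      {x : ℝ | ε * GreedyMIS.rootDensity U < |x - GreedyMIS.rootDensity U|} := by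
    ext x
    simp only [Set.mem_compl_iff, Set.mem_ofPred_eq, not_le]
  rw [hcompl] at hsum
  refine (ENNReal.eq_sub_of_add_eq ?_ hsum).symm
  exact ne_top_of_le_ne_top ENNReal.one_ne_top (le_add_self.trans hsum.le)
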